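/- Let $K$ be an algebraically closed field of characteristic $0$. For a point $P\in\mathbf P^2=\mathbf P^2_K$ and an integer $d\ge 1$ let $dP$ be the fat point of multiplicity $d$ at $P$, i.e. the zero-dimensional subscheme with ideal sheaf $(\mathcal I_P)^d$, which has length $d(d+1)/2$. Fix positive integers $t,r,e$ and $d_1,\dots,d_r$; set $d_j=2$ for $r<j\le r+e$ and $m=\max\{d_j : 1\le j\le r+e\}$. Assume $$\frac{(t+2)(t+1)}{2}\ \ge\ 1+\sum_{j=1}^{r+e}\frac{d_j(d_j+1)}{2}\qquad\text{and}\qquad e\ \ge\ \frac{(m-1)(t-1)}{2}.$$ Then for general points $P_1,\dots,P_{r+e}$ of $\mathbf P^2$ (that is, for all $(P_1,\dots,P_{r+e})$ in some nonempty Zariski open subset of $(\mathbf P^2)^{r+e}$ consisting of tuples of pairwise distinct points), the scheme $Z=\bigcup_{j=1}^{r+e} d_jP_j$ satisfies $$h^1(\mathbf P^2,\mathcal I_Z(t))=0 ,$$ so $Z$ imposes independent conditions on plane curves of degree $t$: the forms of degree $t$ vanishing on $Z$ have codimension $\sum_{j} d_j(d_j+1)/2$ in the space of all forms of degree $t$.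 -/

import Mathlib

open MvPolynomial
open scoped LinearAlgebra.Projectivization

noncomputable section

namespace FatPoints

variable {K : Type*} [Field K]

/-- The (closed points of the) projective plane over `K`, with homogeneous coordinates
`x₀, x₁, x₂`. -/
abbrev P2 (K : Type*) [Field K] : Type _ := ℙ K (Fin 3 → K)

/-- The homogeneous coordinate ring `K[x₀, x₁, x₂]` of the plane. -/
abbrev CoordRing (K : Type*) [Field K] : Type _ := MvPolynomial (Fin 3) K

/-- The field `K(x₀, x₁, x₂)`; the rational sections of `O(t)` are its homogeneous elements
of degree `t`. -/
abbrev RatField (K : Type*) [Field K] : Type _ := FractionRing (MvPolynomial (Fin 3) K)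

/-- The homogeneous ideal of a point `Q`: it is generated by the forms that vanish at `Q`. -/
def pointIdeal (Q : P2 K) : Ideal (CoordRing K) :=
  Ideal.span {f | (∃ n : ℕ, f.IsHomogeneous n) ∧ eval Q.rep f = 0}

/-- The sections over `U` of the sheaf `I_Z(t)`, where `Z` is the union of the fat points
`d j • P j`, the fat point `d • Q` being defined by the `d`-th power of the ideal sheaf of `Q`.
A section over a nonempty Zariski open set `U` is a rational section `F` of `O(t)` that can be
written near every point `Q` of `U` as a quotient `a / b` of forms with
`deg a = deg b + t` and `b(Q) ≠ 0`, where moreover `a` lies in the `d j`-th power of the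
ideal of `Q` whenever `Q` is the point `P j` (so the germ of `F` at `P j` lies in
`𝔪 ^ (d j) • O(t)`, with `𝔪` the maximal ideal of the local ring at `P j`).
Since the plane is irreducible, the restriction maps of this sheaf between nonempty open sets
are inclusions of subspaces of `K(x₀, x₁, x₂)`. -/
def idealSheafSections {ι : Type*} (P : ι → P2 K) (d : ι → ℕ) (t : ℕ) (U : Set (P2 K)) :
    Submodule K (RatField K) where
  carrier := {F | ∀ Q ∈ U, ∃ (s : ℕ) (a b : CoordRing K),
    a.IsHomogeneous (s + t) ∧ b.IsHomogeneous s ∧ eval Q.rep b ≠ 0 ∧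
    (∀ j, P j = Q → a ∈ pointIdeal Q ^ d j) ∧
    F = algebraMap (CoordRing K) (RatField K) a / algebraMap (CoordRing K) (RatField K) b}
  zero_mem' := fun Q _ => ⟨0, 0, 1, isHomogeneous_zero _ _ _, isHomogeneous_one _ _,
    by simp, fun _ _ => Ideal.zero_mem _, by simp⟩
  add_mem' := by
    intro F G hF hG Q hQ
    obtain ⟨s, a, b, ha, hb, hbQ, haP, rfl⟩ := hF Q hQ
    obtain ⟨s', a', b', ha', hb', hbQ', haP', rfl⟩ := hG Q hQ
    have h0 : ∀ c : CoordRing K, eval Q.rep c ≠ 0 →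
        algebraMap (CoordRing K) (RatField K) c ≠ 0 := by
      intro c hc h
      rw [map_eq_zero_iff _ (IsFractionRing.injective (CoordRing K) (RatField K))] at h
      exact hc (by simp [h])
    refine ⟨s + s', a * b' + b * a', b * b', ?_, hb.mul hb', ?_, ?_, ?_⟩
    · refine IsHomogeneous.add ?_ ?_
      · have := ha.mul hb'
        rwa [show s + t + s' = s + s' + t by ring] at this
      · have := hb.mul ha'
        rwa [show s + (s' + t) = s + s' + t by ring] at this
    · rw [map_mul]
      exact mul_ne_zero hbQ hbQ'
    · intro j hj
      exact Ideal.add_mem _ (Ideal.mul_mem_right _ _ (haP j hj))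
        (Ideal.mul_mem_left _ _ (haP' j hj))
    · rw [div_add_div _ _ (h0 b hbQ) (h0 b' hbQ')]
      simp only [map_add, map_mul]
  smul_mem' := by
    intro c F hF Q hQ
    obtain ⟨s, a, b, ha, hb, hbQ, haP, rfl⟩ := hF Q hQ
    refine ⟨s, C c * a, b, ?_, hb, hbQ, fun j hj => Ideal.mul_mem_left _ _ (haP j hj), ?_⟩
    · have := (isHomogeneous_C (Fin 3) c).mul ha
      rwa [zero_add] at this
    · rw [Algebra.smul_def, map_mul, mul_div_assoc]
      rfl

/-- The standard affine open set `x_i ≠ 0`. -/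
def stdAffine (i : Fin 3) : Set (P2 K) := {Q | Q.rep i ≠ 0}

/-- The Čech 1-cocycles of `I_Z(t)` for the standard affine cover of the plane. -/
def cechZ1 {ι : Type*} (P : ι → P2 K) (d : ι → ℕ) (t : ℕ) :
    Submodule K (Fin 3 → Fin 3 → RatField K) where
  carrier := {g | (∀ i j, g i j ∈ idealSheafSections P d t (stdAffine i ∩ stdAffine j)) ∧
    ∀ i j k, g j k - g i k + g i j = 0}
  zero_mem' := ⟨fun _ _ => Submodule.zero_mem _, fun _ _ _ => by simp⟩
  add_mem' := by
    rintro g h ⟨hg, hg'⟩ ⟨hh, hh'⟩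
    refine ⟨fun i j => Submodule.add_mem _ (hg i j) (hh i j), fun i j k => ?_⟩
    simp only [Pi.add_apply]
    linear_combination hg' i j k + hh' i j k
  smul_mem' := by
    rintro c g ⟨hg, hg'⟩
    refine ⟨fun i j => Submodule.smul_mem _ c (hg i j), fun i j k => ?_⟩
    simp only [Pi.smul_apply]
    rw [← smul_sub, ← smul_add, hg' i j k, smul_zero]

/-- The Čech 1-coboundaries of `I_Z(t)` for the standard affine cover of the plane. -/
def cechB1 {ι : Type*} (P : ι → P2 K) (d : ι → ℕ) (t : ℕ) :
    Submodule K (Fin 3 → Fin 3 → RatField K) where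
  carrier := {g | ∃ f : Fin 3 → RatField K,
    (∀ i, f i ∈ idealSheafSections P d t (stdAffine i)) ∧ ∀ i j, g i j = f j - f i}
  zero_mem' := ⟨0, fun _ => Submodule.zero_mem _, fun _ _ => by simp⟩
  add_mem' := by
    rintro g h ⟨f, hf, hg⟩ ⟨f', hf', hh⟩
    refine ⟨f + f', fun i => Submodule.add_mem _ (hf i) (hf' i), fun i j => ?_⟩
    simp only [Pi.add_apply, hg, hh]
    ring
  smul_mem' := by
    rintro c g ⟨f, hf, hg⟩
    refine ⟨c • f, fun i => Submodule.smul_mem _ c (hf i), fun i j => ?_⟩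
    simp only [Pi.smul_apply, hg, smul_sub]

/-- The cohomology space `H¹(ℙ², I_Z(t))`, computed by the Čech complex of the standard affine
cover (the intersections of its members are affine and `I_Z(t)` is coherent). -/
abbrev H1 {ι : Type*} (P : ι → P2 K) (d : ι → ℕ) (t : ℕ) : Type _ :=
  cechZ1 P d t ⧸ (cechB1 P d t).submoduleOf (cechZ1 P d t)

/-- `h¹(ℙ², I_Z(t))`, the dimension of `H¹(ℙ², I_Z(t))`, as a cardinal. -/
def h1 {ι : Type*} (P : ι → P2 K) (d : ι → ℕ) (t : ℕ) : Cardinal :=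
  Module.rank K (H1 P d t)

/-- The forms of degree `t` that vanish on `Z`, i.e. that lie in the `d j`-th power of the ideal
of `P j` for every `j`. -/
def formsThrough {ι : Type*} (P : ι → P2 K) (d : ι → ℕ) (t : ℕ) :
    Submodule K (CoordRing K) :=
  homogeneousSubmodule (Fin 3) K t ⊓
    (⨅ j, pointIdeal (P j) ^ d j : Ideal (CoordRing K)).restrictScalars K

/-- `Z` imposes independent conditions on the plane curves of degree `t`: the forms of degree `t`
vanishing on `Z` have codimension `length Z = ∑ d j (d j + 1) / 2` among all forms of
degree `t`. -/
def ImposesIndependentConditions {ι : Type*} [Fintype ι] (P : ι → P2 K) (d : ι → ℕ) (t : ℕ) :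
    Prop :=
  Module.finrank K (formsThrough P d t) + ∑ j, d j * (d j + 1) / 2 =
    Module.finrank K (homogeneousSubmodule (Fin 3) K t)

/-- Zariski open subsets of the product of copies of the plane indexed by `ι`: the complements of
the common zero sets of families of multihomogeneous polynomials. -/
def IsZariskiOpen {ι : Type*} [DecidableEq ι] (U : Set (ι → P2 K)) : Prop :=
  ∃ T : Set (MvPolynomial (ι × Fin 3) K),
    (∀ g ∈ T, ∃ D : ι → ℕ,
      IsWeightedHomogeneous (fun p : ι × Fin 3 => (Pi.single p.1 1 : ι → ℕ)) g D) ∧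
    ∀ P : ι → P2 K, P ∈ U ↔ ∃ g ∈ T, eval (fun p : ι × Fin 3 => (P p.1).rep p.2) g ≠ 0

/-- A property holds for the general multi-jet `⋃ d j • P j` of fixed type, if it holds for all
tuples of pairwise distinct points in a nonempty Zariski open subset, made of such tuples, of the
product of copies of the plane. -/
def ForGeneralPoints {ι : Type*} [DecidableEq ι] (p : (ι → P2 K) → Prop) : Prop :=
  ∃ U : Set (ι → P2 K), IsZariskiOpen U ∧ U.Nonempty ∧
    ∀ P ∈ U, Function.Injective P ∧ p P

end FatPoints

end

/-!
Independence of the conditions imposed by points of given multiplicities is an open condition on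
the points, so it suffices to find one configuration with independent conditions
(`forGeneralPoints_of_exists`). The openness is witnessed by the determinant of the square matrix of
the conditions imposed by variable points on fixed forms that are dual to the conditions at the
special configuration. The forms that can meet the conditions with arbitrary values then also kill
the first cohomology (`cechZ1_le_cechB1`): a section on the intersection of two standard open sets
is a fraction whose denominator is a power of the two coordinates, by the Nullstellensatz; since the
coordinates form a regular sequence, a cocycle of `O(t)` is a coboundary; and its local primitives
can be corrected by one form of degree `t` so that they vanish suitably at all points.

The special configuration lies in the affine chart, where `dim Z j` is the dimension of the space of
polynomials of degree at most `j` through `Z`. It is built by a Horace method with vertical lines.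
The difference `rk Z j = dim Z j - dim Z (j - 1)` is the rank of the restriction to any line
`x = c` that avoids `Z`. In characteristic zero, vanishing to order `a` at a general point of
a line imposes the maximal number of conditions on a given linear system on that line: the Wronskian
with one member of the system lowers the dimension and the order of vanishing by one. Applied to the
successive residuals, this shows that `q` points of multiplicity `d` on a general line satisfy
`dim (Z + Q) j ≤ ∑ b < d, max 0 (rk Z (j - b) - q * (d - b)) + dim Z (j - d)` in all degrees
`j ≤ T` at once (`exists_batch`). The ranks grow strictly as soon as they are positive
(`rk_add_one_le`).

By adding double points one may assume that the expected dimension in degree `t` is one, two or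
three. The points of multiplicity at least three are added first; they impose independent conditions
in degree `t - 1`, and the bound on the number `e` of double points ensures that only few conditions
are lost in the degrees `t - 2` and `t - 3` (`exists_points_three_le`). Then double points are added
one by one (`exists_descent`, `exists_balance`) until the remaining ones can be put on two lines,
the second of which takes `⌊(t + 1) / 2⌋` points (`exists_two_batches`). Simple points are added last.
-/

noncomputable section

namespace FatPoints

variable {K : Type*} [Field K]

/-! ### Linear systems of polynomials in one variable -/

section Univariate

open Polynomial (taylor)

theorem finrank_map_add_finrank_inf_ker {V M : Type*} [AddCommGroup V] [Module K V]
    [AddCommGroup M] [Module K M] (φ : V →ₗ[K] M) (W : Submodule K V) [FiniteDimensional K W] :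
    Module.finrank K (W.map φ) + Module.finrank K (W ⊓ LinearMap.ker φ : Submodule K V) =
      Module.finrank K W := by
  have h := LinearMap.finrank_range_add_finrank_ker (φ.domRestrict W)
  have h2 : Module.finrank K (LinearMap.ker (φ.domRestrict W)) =
      Module.finrank K (W ⊓ LinearMap.ker φ : Submodule K V) := by
    rw [LinearMap.ker_domRestrict]
    exact (Submodule.equivSubtypeMap W _ ).finrank_eq.trans
      (by rw [Submodule.map_comap_subtype])
  rw [LinearMap.range_domRestrict] at h
  omega

theorem finrank_le_finrank_inf_ker_add {V M : Type*} [AddCommGroup V] [Module K V]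
    [AddCommGroup M] [Module K M] [FiniteDimensional K M] (φ : V →ₗ[K] M) (W : Submodule K V)
    [FiniteDimensional K W] :
    Module.finrank K W ≤
      Module.finrank K (W ⊓ LinearMap.ker φ : Submodule K V) + Module.finrank K M := by
  have h := finrank_map_add_finrank_inf_ker φ W
  have h1 := Submodule.finrank_le (W.map φ)
  omega

/-- A linear system of polynomials of dimension at most `n` contains no nonzero element vanishing
to order `n` at `β`, for all but finitely many `β`. -/
theorem exists_finset_forall_pow_dvd_eq_zero [CharZero K] (n : ℕ) :
    ∀ (W : Submodule K (Polynomial K)) [FiniteDimensional K W], Module.finrank K W ≤ n →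
      ∃ S : Finset K, ∀ β ∉ S, ∀ g ∈ W, (Polynomial.X - Polynomial.C β) ^ n ∣ g → g = 0 := by
  classical
  induction n with
  | zero =>
    intro W _ hW
    refine ⟨∅, fun β _ g hg _ => ?_⟩
    have : W = ⊥ := Submodule.finrank_eq_zero.1 (by omega)
    simpa [this] using hg
  | succ n ih =>
    intro W _ hW
    by_cases hbot : W = ⊥
    · exact ⟨∅, fun β _ g hg _ => by simpa [hbot] using hg⟩
    obtain ⟨f, hf, hf0⟩ := Submodule.exists_mem_ne_zero_of_ne_bot hbot
    let φ : Polynomial K →ₗ[K] Polynomial K :=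
      (LinearMap.mulLeft K f).comp Polynomial.derivative -
        LinearMap.mulLeft K (Polynomial.derivative f)
    have hφ : ∀ g, φ g = f * Polynomial.derivative g - Polynomial.derivative f * g := fun g => rfl
    -- in characteristic zero the Wronskian with `f` detects multiples of `f`
    have hdeg : ∀ g, φ g = 0 → g ≠ 0 → g.natDegree = f.natDegree := by
      intro g hg hg0
      by_contra hne
      rw [hφ, sub_eq_zero] at hg
      by_cases hf1 : f.natDegree = 0
      · obtain ⟨c, rfl⟩ := Polynomial.natDegree_eq_zero.1 hf1
        simp only [Polynomial.derivative_C, zero_mul, mul_eq_zero, hf0, false_or] at hg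
        exact hne (by rw [Polynomial.derivative_eq_zero.1 hg, hf1])
      by_cases hg1 : g.natDegree = 0
      · obtain ⟨c, rfl⟩ := Polynomial.natDegree_eq_zero.1 hg1
        simp only [Polynomial.derivative_C, mul_zero] at hg
        rcases mul_eq_zero.1 hg.symm with h | h
        · exact hf1 (Polynomial.derivative_eq_zero.1 h)
        · exact hg0 h
      have e := congrArg (fun p => p.coeff (f.natDegree + (g.natDegree - 1))) hg
      beta_reduce at e
      have e1 := Polynomial.coeff_mul_add_eq_of_natDegree_le (f := f) (g := Polynomial.derivative g)
        le_rfl (Polynomial.natDegree_derivative_le g)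
      have e2 := Polynomial.coeff_mul_add_eq_of_natDegree_le (f := Polynomial.derivative f) (g := g)
        (Polynomial.natDegree_derivative_le f) le_rfl
      rw [show f.natDegree + (g.natDegree - 1) = f.natDegree - 1 + g.natDegree by omega, e2] at e
      rw [show f.natDegree + (g.natDegree - 1) = f.natDegree - 1 + g.natDegree by omega] at e1
      rw [e1, Polynomial.coeff_derivative, Polynomial.coeff_derivative] at e
      rw [show g.natDegree - 1 + 1 = g.natDegree by omega,
        show f.natDegree - 1 + 1 = f.natDegree by omega] at e
      have hl1 : f.coeff f.natDegree ≠ 0 := by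
        simpa using Polynomial.leadingCoeff_ne_zero.2 hf0
      have hl2 : g.coeff g.natDegree ≠ 0 := by
        simpa using Polynomial.leadingCoeff_ne_zero.2 hg0
      have hc : ∀ m : ℕ, m ≠ 0 → (((m - 1 : ℕ) : K) + 1) = m := by
        intro m hm
        have : ((m - 1 + 1 : ℕ) : K) = m := by rw [Nat.sub_add_cancel (Nat.pos_of_ne_zero hm)]
        push_cast at this
        exact this
      rw [hc _ hf1, hc _ hg1] at e
      have e3 : (f.coeff f.natDegree * g.coeff g.natDegree) *
          ((g.natDegree : K) - f.natDegree) = 0 := by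
        linear_combination e
      rcases mul_eq_zero.1 e3 with h | h
      · exact (mul_ne_zero hl1 hl2) h
      · exact hne (by exact_mod_cast sub_eq_zero.1 h)
    have hker : ∀ g ∈ W, φ g = 0 → ∃ c : K, g = Polynomial.C c * f := by
      intro g hg hg'
      by_cases hg0 : g = 0
      · exact ⟨0, by simp [hg0]⟩
      refine ⟨g.leadingCoeff / f.leadingCoeff, ?_⟩
      set c := g.leadingCoeff / f.leadingCoeff with hc
      by_contra hne
      have hne' : g - Polynomial.C c * f ≠ 0 := sub_ne_zero.2 hne
      have hmem : g - Polynomial.C c * f ∈ W := by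
        refine W.sub_mem hg ?_
        rw [← Polynomial.smul_eq_C_mul]
        exact W.smul_mem c hf
      have hz : φ (g - Polynomial.C c * f) = 0 := by
        rw [map_sub, hg', ← Polynomial.smul_eq_C_mul, map_smul, hφ f, mul_comm, sub_self]
        simp
      have hlt : (g - Polynomial.C c * f).degree < g.degree := by
        have hlf : f.leadingCoeff ≠ 0 := Polynomial.leadingCoeff_ne_zero.2 hf0
        have hlg : g.leadingCoeff ≠ 0 := Polynomial.leadingCoeff_ne_zero.2 hg0
        have hc0 : c ≠ 0 := div_ne_zero hlg hlf
        refine Polynomial.degree_sub_lt_left ?_ hg0 ?_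
        · rw [Polynomial.degree_C_mul hc0, Polynomial.degree_eq_natDegree hg0,
            Polynomial.degree_eq_natDegree hf0, hdeg g hg' hg0]
        · rw [Polynomial.leadingCoeff_mul, Polynomial.leadingCoeff_C, hc, div_mul_cancel₀ _ hlf]
      have h1 := Polynomial.natDegree_lt_natDegree hne' hlt
      rw [hdeg _ hz hne', hdeg g hg' hg0] at h1
      exact lt_irrefl _ h1
    have hfin : Module.finrank K (W.map φ) ≤ n := by
      have h := LinearMap.finrank_range_add_finrank_ker (φ.domRestrict W)
      rw [LinearMap.range_domRestrict] at h
      have hpos : 0 < Module.finrank K (LinearMap.ker (φ.domRestrict W)) := by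
        refine Nat.pos_of_ne_zero fun h0 => hf0 ?_
        have hmem : (⟨f, hf⟩ : W) ∈ LinearMap.ker (φ.domRestrict W) := by
          rw [LinearMap.mem_ker, LinearMap.domRestrict_apply, hφ, mul_comm, sub_self]
        rw [Submodule.finrank_eq_zero.1 h0, Submodule.mem_bot] at hmem
        exact congrArg Subtype.val hmem
      omega
    obtain ⟨S, hS⟩ := ih (W.map φ) hfin
    refine ⟨S ∪ f.roots.toFinset, fun β hβ g hg hdvd => ?_⟩
    rw [Finset.mem_union, not_or] at hβ
    have hfβ : f.eval β ≠ 0 := by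
      intro h
      exact hβ.2 (by simpa [hf0] using h)
    have h1 : φ g = 0 := by
      refine hS β hβ.1 _ (Submodule.mem_map_of_mem hg) ?_
      rw [hφ]
      refine dvd_sub (Dvd.dvd.mul_left ?_ _)
        (Dvd.dvd.mul_left ((pow_dvd_pow _ n.le_succ).trans hdvd) _)
      obtain ⟨h, rfl⟩ := hdvd
      rw [Polynomial.derivative_mul, Polynomial.derivative_pow]
      simp only [Nat.add_sub_cancel, Polynomial.derivative_sub, Polynomial.derivative_X,
        Polynomial.derivative_C, sub_zero, mul_one]
      refine dvd_add (Dvd.dvd.mul_right (Dvd.dvd.mul_left dvd_rfl _) _) ?_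
      exact Dvd.dvd.mul_right (pow_dvd_pow _ n.le_succ) _
    obtain ⟨c, rfl⟩ := hker g hg h1
    have h2 : (Polynomial.X - Polynomial.C β) ∣ Polynomial.C c * f :=
      (dvd_pow_self _ n.succ_ne_zero).trans hdvd
    rw [Polynomial.dvd_iff_isRoot, Polynomial.IsRoot, Polynomial.eval_mul, Polynomial.eval_C,
      mul_eq_zero] at h2
    rcases h2 with h2 | h2
    · simp [h2]
    · exact absurd h2 hfβ

/-- The polynomials vanishing to order at least `a` at `β`. -/
def vanishingAt (β : K) (a : ℕ) : Submodule K (Polynomial K) :=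
  (Ideal.span {(Polynomial.X - Polynomial.C β) ^ a}).restrictScalars K

theorem mem_vanishingAt {β : K} {a : ℕ} {g : Polynomial K} :
    g ∈ vanishingAt β a ↔ (Polynomial.X - Polynomial.C β) ^ a ∣ g := by
  simp [vanishingAt, Ideal.mem_span_singleton]

theorem mem_vanishingAt_iff_coeff {β : K} {a : ℕ} {g : Polynomial K} :
    g ∈ vanishingAt β a ↔ ∀ i < a, (taylor β g).coeff i = 0 := by
  rw [mem_vanishingAt, ← Polynomial.X_pow_dvd_iff,
    ← map_dvd_iff (Polynomial.taylorEquiv β)]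
  simp [Polynomial.taylorEquiv]

/-- At all but finitely many points, vanishing to order `a` imposes `min a (dim W)` conditions on a
linear system `W` of polynomials. -/
theorem exists_finset_finrank_inf_vanishingAt_le [CharZero K] (W : Submodule K (Polynomial K))
    [FiniteDimensional K W] :
    ∃ S : Finset K, ∀ β ∉ S, ∀ a : ℕ,
      Module.finrank K (W ⊓ vanishingAt β a : Submodule K _) ≤ Module.finrank K W - a := by
  obtain ⟨S, hS⟩ := exists_finset_forall_pow_dvd_eq_zero (Module.finrank K W) W le_rfl
  refine ⟨S, fun β hβ a => ?_⟩
  have hbot : ∀ a, Module.finrank K W ≤ a → (W ⊓ vanishingAt β a : Submodule K _) = ⊥ := by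
    intro a ha
    rw [eq_bot_iff]
    rintro g ⟨hg, hg'⟩
    exact hS β hβ g hg ((pow_dvd_pow _ ha).trans (mem_vanishingAt.1 hg'))
  have hstep : ∀ a, Module.finrank K (W ⊓ vanishingAt β a : Submodule K _) ≤
      Module.finrank K (W ⊓ vanishingAt β (a + 1) : Submodule K _) + 1 := by
    intro a
    have h := finrank_le_finrank_inf_ker_add
      ((Polynomial.lcoeff K a).comp (taylor β : Polynomial K →ₗ[K] Polynomial K))
      (W ⊓ vanishingAt β a)
    rw [Module.finrank_self] at h
    refine h.trans (Nat.add_le_add_right (Submodule.finrank_mono ?_) 1)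
    rintro g ⟨⟨hg, hg'⟩, hg''⟩
    refine ⟨hg, mem_vanishingAt_iff_coeff.2 fun i hi => ?_⟩
    rcases Nat.lt_succ_iff_lt_or_eq.1 hi with h | rfl
    · exact mem_vanishingAt_iff_coeff.1 hg' i h
    · simpa using hg''
  have key : ∀ m a, Module.finrank K W - a = m →
      Module.finrank K (W ⊓ vanishingAt β a : Submodule K _) ≤ m := by
    intro m
    induction m with
    | zero =>
      intro a ha
      rw [hbot a (by omega)]
      simp
    | succ m ih =>
      intro a ha
      exact (hstep a).trans (Nat.add_le_add_right (ih (a + 1) (by omega)) 1)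
  exact key _ a rfl

end Univariate

/-! ### Linear systems of plane curves in an affine chart -/

/-- The Taylor expansion `h(p + T x)` of a polynomial in two variables at the point `p`, a
polynomial in the scale variable `T`. The order of vanishing of `h` at `p` is at least `d` if and
only if `T ^ d` divides it. -/
def taylorAt (p : K × K) :
    MvPolynomial (Fin 2) K →ₐ[K] Polynomial (MvPolynomial (Fin 2) K) :=
  aeval ![Polynomial.X * Polynomial.C (X 0) + Polynomial.C (C p.1),
    Polynomial.X * Polynomial.C (X 1) + Polynomial.C (C p.2)]

/-- The restriction of polynomials in two variables to the line `x = c`. -/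
def lineMap (c : K) : MvPolynomial (Fin 2) K →ₐ[K] Polynomial K :=
  aeval ![Polynomial.C c, Polynomial.X]

/-- The polynomials of degree at most `j` in two variables that vanish to order at least `d` at `p`
for every pair `(p, d)` in `Z`. The degree bound is an integer, and the space is zero if it is
negative. -/
def linSys (Z : Multiset ((K × K) × ℕ)) (j : ℤ) : Submodule K (MvPolynomial (Fin 2) K) where
  carrier := {h | (h ≠ 0 → (h.totalDegree : ℤ) ≤ j) ∧
    ∀ z ∈ Z, Polynomial.X ^ z.2 ∣ taylorAt z.1 h}
  zero_mem' := ⟨fun h => absurd rfl h, fun z _ => by simp⟩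
  add_mem' := by
    rintro f g ⟨hf, hf'⟩ ⟨hg, hg'⟩
    refine ⟨fun hne => ?_, fun z hz => by rw [map_add]; exact dvd_add (hf' z hz) (hg' z hz)⟩
    by_cases hf0 : f = 0
    · subst hf0
      simpa using hg (by simpa using hne)
    by_cases hg0 : g = 0
    · subst hg0
      simpa using hf hf0
    have h1 := totalDegree_add f g
    have h2 := hf hf0
    have h3 := hg hg0
    omega
  smul_mem' := by
    rintro c f ⟨hf, hf'⟩
    refine ⟨fun hne => ?_, fun z hz => ?_⟩
    · have h1 := totalDegree_smul_le c f
      have h2 := hf (by rintro rfl; simp at hne)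
      omega
    · rw [map_smul, Algebra.smul_def]
      exact Dvd.dvd.mul_left (hf' z hz) _

theorem linSys_eq_bot (Z : Multiset ((K × K) × ℕ)) {j : ℤ} (hj : j < 0) : linSys Z j = ⊥ := by
  rw [eq_bot_iff]
  rintro h ⟨hh, -⟩
  by_contra h0
  have := hh h0
  omega

instance (Z : Multiset ((K × K) × ℕ)) (j : ℤ) : FiniteDimensional K (linSys Z j) := by
  refine Submodule.finiteDimensional_of_le (S₂ := restrictTotalDegree (Fin 2) K j.toNat) ?_
  rintro h ⟨hh, -⟩
  rw [mem_restrictTotalDegree]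
  by_cases h0 : h = 0
  · simp [h0]
  · have := hh h0
    omega

theorem linSys_anti {Z Z' : Multiset ((K × K) × ℕ)} (h : Z ≤ Z') (j : ℤ) :
    linSys Z' j ≤ linSys Z j :=
  fun _ hf => ⟨hf.1, fun z hz => hf.2 z (Multiset.mem_of_le h hz)⟩

/-- The dimension of the linear system `linSys Z j`. -/
def dim (Z : Multiset ((K × K) × ℕ)) (j : ℤ) : ℤ := Module.finrank K (linSys Z j)

/-- The difference function of `dim Z`; it is the rank of the restriction of `linSys Z j` to any
line that avoids the points of `Z`. -/
def rk (Z : Multiset ((K × K) × ℕ)) (j : ℤ) : ℤ := dim Z j - dim Z (j - 1)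

theorem dim_nonneg (Z : Multiset ((K × K) × ℕ)) (j : ℤ) : 0 ≤ dim Z j := Int.natCast_nonneg _

theorem dim_eq_zero (Z : Multiset ((K × K) × ℕ)) {j : ℤ} (hj : j < 0) : dim Z j = 0 := by
  rw [dim, linSys_eq_bot Z hj]
  simp

theorem dim_anti {Z Z' : Multiset ((K × K) × ℕ)} (h : Z ≤ Z') (j : ℤ) : dim Z' j ≤ dim Z j :=
  Int.ofNat_le.2 (Submodule.finrank_mono (linSys_anti h j))

theorem totalDegree_line (c : K) :
    (X 0 - C c : MvPolynomial (Fin 2) K).totalDegree = 1 := by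
  refine le_antisymm ((totalDegree_sub _ _).trans (by simp)) ?_
  rw [Nat.one_le_iff_ne_zero]
  intro h
  rw [totalDegree_eq_zero_iff_eq_C] at h
  have := congrArg (coeff (Finsupp.single (0 : Fin 2) 1)) h
  simp [coeff_C, coeff_X, Finsupp.single_eq_zero] at this

theorem line_ne_zero (c : K) : (X 0 - C c : MvPolynomial (Fin 2) K) ≠ 0 := by
  intro h
  have := totalDegree_line c
  rw [h] at this
  simp at this

theorem line_dvd_of_lineMap_eq_zero {c : K} {h : MvPolynomial (Fin 2) K}
    (hh : lineMap c h = 0) : (X 0 - C c) ∣ h := by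
  let I : Ideal (MvPolynomial (Fin 2) K) := Ideal.span {X 0 - C c}
  have key : (Ideal.Quotient.mkₐ K I) =
      ((Ideal.Quotient.mkₐ K I).comp (Polynomial.aeval (X 1))).comp (lineMap c) := by
    refine algHom_ext fun i => ?_
    fin_cases i
    · simp only [lineMap, AlgHom.comp_apply, aeval_X, Fin.zero_eta, Matrix.cons_val_zero,
        Polynomial.aeval_C, Ideal.Quotient.mkₐ_eq_mk]
      rw [Ideal.Quotient.eq]
      exact Ideal.subset_span rfl
    · simp [lineMap]
  have h1 := DFunLike.congr_fun key h
  rw [AlgHom.comp_apply, hh, map_zero, Ideal.Quotient.mkₐ_eq_mk,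
    Ideal.Quotient.eq_zero_iff_mem] at h1
  exact Ideal.mem_span_singleton.1 h1

theorem taylorAt_line (p : K × K) (c : K) : taylorAt p (X 0 - C c) =
    Polynomial.X * Polynomial.C (X 0) + Polynomial.C (C (p.1 - c)) := by
  simp only [taylorAt, map_sub, aeval_X, Matrix.cons_val_zero, aeval_C,
    Polynomial.algebraMap_apply, MvPolynomial.algebraMap_eq]
  ring

theorem pow_dvd_taylorAt_of_line_mul {p : K × K} {c : K} (hp : p.1 ≠ c) {d : ℕ}
    {g : MvPolynomial (Fin 2) K} (h : Polynomial.X ^ d ∣ taylorAt p ((X 0 - C c) * g)) :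
    Polynomial.X ^ d ∣ taylorAt p g := by
  rw [map_mul] at h
  refine Polynomial.prime_X.pow_dvd_of_dvd_mul_left _ ?_ h
  rw [taylorAt_line, Polynomial.X_dvd_iff]
  simp [sub_eq_zero, hp]

/-- Residuation with respect to a line through a point lowers the multiplicity by one. -/
theorem pow_dvd_taylorAt_of_line_mul_self {c β : K} {d : ℕ}
    {g : MvPolynomial (Fin 2) K}
    (h : Polynomial.X ^ (d + 1) ∣ taylorAt (c, β) ((X 0 - C c) * g)) :
    Polynomial.X ^ d ∣ taylorAt (c, β) g := by
  rw [map_mul, taylorAt_line, sub_self, C_0, Polynomial.C_0, add_zero, pow_succ',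
    mul_assoc, mul_dvd_mul_iff_left Polynomial.X_ne_zero] at h
  refine Polynomial.prime_X.pow_dvd_of_dvd_mul_left _ ?_ h
  rw [Polynomial.X_dvd_iff]
  simp

/-- The trace of a fat point on a line through it is a divisor of the same multiplicity. -/
theorem pow_dvd_lineMap {c β : K} {d : ℕ} {h : MvPolynomial (Fin 2) K}
    (hh : Polynomial.X ^ d ∣ taylorAt (c, β) h) :
    (Polynomial.X - Polynomial.C β) ^ d ∣ lineMap c h := by
  let θ : Polynomial (MvPolynomial (Fin 2) K) →+* Polynomial K :=
    Polynomial.eval₂RingHom (aeval ![0, 1] : MvPolynomial (Fin 2) K →ₐ[K] Polynomial K).toRingHom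
      (Polynomial.X - Polynomial.C β)
  have key : (lineMap c : MvPolynomial (Fin 2) K →+* Polynomial K) =
      θ.comp (taylorAt (c, β) : MvPolynomial (Fin 2) K →+* _) := by
    refine ringHom_ext (fun a => ?_) fun i => ?_
    · simp [lineMap, taylorAt, θ]
    · fin_cases i
      · simp [lineMap, taylorAt, θ]
      · simp [lineMap, taylorAt, θ]
  have := map_dvd θ hh
  rw [map_pow] at this
  have key' : lineMap c h = θ (taylorAt (c, β) h) := DFunLike.congr_fun key h
  rw [key']
  simpa [θ] using this

/-! ### Restriction to a line and residuation -/

/-- The restrictions to the line `x = c` of the members of `linSys Z j`. -/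
def lineSys (c : K) (Z : Multiset ((K × K) × ℕ)) (j : ℤ) : Submodule K (Polynomial K) :=
  (linSys Z j).map (lineMap c).toLinearMap

instance (c : K) (Z : Multiset ((K × K) × ℕ)) (j : ℤ) : FiniteDimensional K (lineSys c Z j) := by
  unfold lineSys
  infer_instance

theorem mul_line_totalDegree {c : K} {g : MvPolynomial (Fin 2) K} (hg : g ≠ 0) :
    ((X 0 - C c) * g).totalDegree = g.totalDegree + 1 := by
  rw [totalDegree_mul_of_isDomain (line_ne_zero c) hg, totalDegree_line, add_comm]

theorem finrank_map_mul_line (c : K) (Z : Multiset ((K × K) × ℕ)) (j : ℤ) :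
    Module.finrank K ((linSys Z j).map (LinearMap.mulLeft K (X 0 - C c))) =
      Module.finrank K (linSys Z j) := by
  refine (Submodule.equivMapOfInjective _ ?_ _).finrank_eq.symm
  intro a b h
  exact mul_left_cancel₀ (line_ne_zero c) h

theorem lineMap_line_mul (c : K) (g : MvPolynomial (Fin 2) K) :
    lineMap c ((X 0 - C c) * g) = 0 := by
  rw [map_mul]
  simp [lineMap]

theorem map_mul_line_eq {c : K} {Z : Multiset ((K × K) × ℕ)} (hc : ∀ z ∈ Z, z.1.1 ≠ c) (j : ℤ) :
    (linSys Z (j - 1)).map (LinearMap.mulLeft K (X 0 - C c)) =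
      linSys Z j ⊓ LinearMap.ker (lineMap c).toLinearMap := by
  ext h
  constructor
  · rintro ⟨g, ⟨hg, hg'⟩, rfl⟩
    refine ⟨⟨fun hne => ?_, fun z hz => ?_⟩, ?_⟩
    · have hg0 : g ≠ 0 := by rintro rfl; simp at hne
      rw [LinearMap.mulLeft_apply, mul_line_totalDegree hg0]
      have := hg hg0
      push_cast
      omega
    · rw [LinearMap.mulLeft_apply, map_mul]
      exact Dvd.dvd.mul_left (hg' z hz) _
    · exact lineMap_line_mul c g
  · rintro ⟨⟨hh, hh'⟩, hk⟩
    obtain ⟨g, rfl⟩ := line_dvd_of_lineMap_eq_zero hk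
    refine ⟨g, ⟨fun hg0 => ?_, fun z hz => pow_dvd_taylorAt_of_line_mul (hc z hz) (hh' z hz)⟩, rfl⟩
    have := hh (mul_ne_zero (line_ne_zero c) hg0)
    rw [mul_line_totalDegree hg0] at this
    push_cast at this
    omega

theorem finrank_lineSys {c : K} {Z : Multiset ((K × K) × ℕ)} (hc : ∀ z ∈ Z, z.1.1 ≠ c) (j : ℤ) :
    (Module.finrank K (lineSys c Z j) : ℤ) = rk Z j := by
  have h := finrank_map_add_finrank_inf_ker (lineMap c).toLinearMap (linSys Z j)
  rw [← map_mul_line_eq hc, finrank_map_mul_line] at h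
  rw [lineSys, rk, dim, dim]
  omega

theorem exists_notMem_line {K : Type*} [Infinite K] (Z : Multiset ((K × K) × ℕ)) :
    ∃ c : K, ∀ z ∈ Z, z.1.1 ≠ c := by
  classical
  obtain ⟨c, hc⟩ := Infinite.exists_notMem_finset (Z.map fun z => z.1.1).toFinset
  refine ⟨c, fun z hz h => hc ?_⟩
  rw [Multiset.mem_toFinset, Multiset.mem_map]
  exact ⟨z, hz, h⟩

/-- The points of multiplicity `a` at the points of the line `x = c` with ordinates in `s`. -/
def fatOnLine (c : K) (s : Finset K) (a : ℕ) : Multiset ((K × K) × ℕ) :=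
  s.val.map fun β => ((c, β), a)

theorem mem_fatOnLine {K : Type*} {c : K} {s : Finset K} {a : ℕ} {z : (K × K) × ℕ} :
    z ∈ fatOnLine c s a ↔ ∃ β ∈ s, ((c, β), a) = z := by
  simp [fatOnLine]

/-- The dimension of the space of those restrictions to the line `x = c` of members of
`linSys Z j` that vanish to order at least `a` at the points with ordinates in `s`. -/
def lineDim (c : K) (Z : Multiset ((K × K) × ℕ)) (s : Finset K) (j : ℤ) (a : ℕ) : ℤ :=
  Module.finrank K (lineSys c Z j ⊓ ⨅ β ∈ s, vanishingAt β a : Submodule K _)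

/-- Horace step: restriction to the line `x = c` and residuation with respect to it. -/
theorem dim_add_fatOnLine_succ_le {c : K} {Z : Multiset ((K × K) × ℕ)}
    (hc : ∀ z ∈ Z, z.1.1 ≠ c) (s : Finset K) (a : ℕ) (j : ℤ) :
    dim (Z + fatOnLine c s (a + 1)) j ≤
      lineDim c Z s j (a + 1) + dim (Z + fatOnLine c s a) (j - 1) := by
  have h := finrank_map_add_finrank_inf_ker (lineMap c).toLinearMap
    (linSys (Z + fatOnLine c s (a + 1)) j)
  have h1 : (linSys (Z + fatOnLine c s (a + 1)) j).map (lineMap c).toLinearMap ≤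
      lineSys c Z j ⊓ ⨅ β ∈ s, vanishingAt β (a + 1) := by
    refine le_inf (Submodule.map_mono (linSys_anti (Multiset.le_add_right _ _) j)) ?_
    rintro _ ⟨h, ⟨-, hh⟩, rfl⟩
    simp only [Submodule.mem_iInf, mem_vanishingAt]
    intro β hβ
    exact pow_dvd_lineMap (hh ((c, β), a + 1)
      (Multiset.mem_add.2 (Or.inr (mem_fatOnLine.2 ⟨β, hβ, rfl⟩))))
  have h2 : linSys (Z + fatOnLine c s (a + 1)) j ⊓ LinearMap.ker (lineMap c).toLinearMap ≤
      (linSys (Z + fatOnLine c s a) (j - 1)).map (LinearMap.mulLeft K (X 0 - C c)) := by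
    rintro h ⟨⟨hh, hh'⟩, hk⟩
    obtain ⟨g, rfl⟩ := line_dvd_of_lineMap_eq_zero hk
    refine ⟨g, ⟨fun hg0 => ?_, fun z hz => ?_⟩, rfl⟩
    · have := hh (mul_ne_zero (line_ne_zero c) hg0)
      rw [mul_line_totalDegree hg0] at this
      push_cast at this
      omega
    · rcases Multiset.mem_add.1 hz with hz | hz
      · exact pow_dvd_taylorAt_of_line_mul (hc z hz)
          (hh' z (Multiset.mem_add.2 (Or.inl hz)))
      · obtain ⟨β, hβ, rfl⟩ := mem_fatOnLine.1 hz
        exact pow_dvd_taylorAt_of_line_mul_self (hh' ((c, β), a + 1)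
          (Multiset.mem_add.2 (Or.inr (mem_fatOnLine.2 ⟨β, hβ, rfl⟩))))
  have h3 := Submodule.finrank_mono h1
  have h4 := Submodule.finrank_mono h2
  rw [finrank_map_mul_line] at h4
  rw [dim, dim, lineDim]
  omega

theorem dim_add_fatOnLine_le {c : K} {Z : Multiset ((K × K) × ℕ)}
    (hc : ∀ z ∈ Z, z.1.1 ≠ c) (s : Finset K) (a : ℕ) : ∀ j : ℤ,
    dim (Z + fatOnLine c s a) j ≤
      ∑ b ∈ Finset.range a, lineDim c Z s (j - b) (a - b) + dim Z (j - a) := by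
  induction a with
  | zero =>
    intro j
    simpa using dim_anti (Multiset.le_add_right Z (fatOnLine c s 0)) j
  | succ a ih =>
    intro j
    rw [Finset.sum_range_succ']
    have h1 := dim_add_fatOnLine_succ_le hc s a j
    have h2 := ih (j - 1)
    have h3 : ∀ b : ℕ, j - 1 - (b : ℤ) = j - ((b + 1 : ℕ) : ℤ) := by intro b; push_cast; ring
    rw [show j - 1 - (a : ℤ) = j - ((a + 1 : ℕ) : ℤ) from h3 a,
      Finset.sum_congr rfl fun b _ => by rw [h3 b]] at h2
    simp only [Nat.add_sub_add_right, Nat.cast_zero, sub_zero, Nat.sub_zero]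
    linarith

/-- Finitely many linear systems on a line can be met simultaneously in the expected way by the
condition of vanishing to order `a` at `q` suitably chosen points. -/
theorem exists_finset_card_finrank_inf_le [CharZero K] {ι : Type*} (I : Finset ι)
    (W : ι → Submodule K (Polynomial K)) [∀ i, FiniteDimensional K (W i)] (d q : ℕ) :
    ∃ s : Finset K, s.card = q ∧ ∀ i ∈ I, ∀ a ≤ d,
      Module.finrank K (W i ⊓ ⨅ β ∈ s, vanishingAt β a : Submodule K _) ≤
        Module.finrank K (W i) - q * a := by
  classical
  induction q with
  | zero => exact ⟨∅, rfl, fun i _ a _ => by simpa using Submodule.finrank_mono inf_le_left⟩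
  | succ q ih =>
    obtain ⟨s, hs, hW⟩ := ih
    have hfin : ∀ i a, FiniteDimensional K
        (W i ⊓ ⨅ β ∈ s, vanishingAt β a : Submodule K (Polynomial K)) :=
      fun i a => Submodule.finiteDimensional_of_le inf_le_left
    choose S hS using fun i a => exists_finset_finrank_inf_vanishingAt_le
      (W i ⊓ ⨅ β ∈ s, vanishingAt β a : Submodule K (Polynomial K))
    obtain ⟨β, hβ⟩ := Infinite.exists_notMem_finset
      (s ∪ I.biUnion fun i => (Finset.range (d + 1)).biUnion fun a => S i a)
    simp only [Finset.mem_union, Finset.mem_biUnion, not_or, not_exists, not_and,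
      Finset.mem_range] at hβ
    refine ⟨insert β s, by rw [Finset.card_insert_of_notMem hβ.1, hs], fun i hi a ha => ?_⟩
    have h1 := hS i a β (hβ.2 i hi a (by omega)) a
    have h2 := hW i hi a ha
    rw [Finset.iInf_insert, inf_comm (vanishingAt β a), ← inf_assoc]
    refine h1.trans ?_
    rw [add_mul, one_mul]
    omega

/-- A batch of `q` points of multiplicity `d` on a general line imposes, in all degrees up to `T`
simultaneously, at least the number of conditions that the ranks `rk` on that line predict. -/
theorem exists_batch [CharZero K] (Z : Multiset ((K × K) × ℕ)) (q d T : ℕ) :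
    ∃ Q : Multiset ((K × K) × ℕ), Q.map Prod.snd = Multiset.replicate q d ∧
      ∀ j : ℤ, j ≤ T → dim (Z + Q) j ≤
        ∑ b ∈ Finset.range d, max 0 (rk Z (j - b) - q * (d - b)) + dim Z (j - d) := by
  obtain ⟨c, hc⟩ := exists_notMem_line Z
  obtain ⟨s, hs, hW⟩ := exists_finset_card_finrank_inf_le (Finset.range (T + 1))
    (fun i : ℕ => lineSys c Z (i : ℤ)) d q
  refine ⟨fatOnLine c s d, ?_, fun j hj => (dim_add_fatOnLine_le hc s d j).trans ?_⟩
  · simp [fatOnLine, Multiset.map_map, hs]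
  · refine add_le_add_left (Finset.sum_le_sum fun b hb => ?_) _
    rw [lineDim]
    have hb' := Finset.mem_range.1 hb
    by_cases hjb : j - b < 0
    · rw [lineSys, linSys_eq_bot Z hjb]
      simp
    · have h1 := hW (j - b).toNat (Finset.mem_range.2 (by omega)) (d - b) (by omega)
      rw [Int.toNat_of_nonneg (by omega)] at h1
      rw [← finrank_lineSys hc]
      have h2 : ((q * (d - b) : ℕ) : ℤ) = q * (d - b) := by
        rw [Nat.cast_mul, Nat.cast_sub hb'.le]
      omega

/-! ### The growth of the ranks on a line -/

section Rank

theorem rk_nonneg [Infinite K] (Z : Multiset ((K × K) × ℕ)) (j : ℤ) : 0 ≤ rk Z j := by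
  obtain ⟨c, hc⟩ := exists_notMem_line Z
  rw [← finrank_lineSys hc]
  exact Int.natCast_nonneg _

theorem lineSys_le_degreeLT (c : K) (Z : Multiset ((K × K) × ℕ)) (j : ℤ) :
    lineSys c Z j ≤ Polynomial.degreeLT K (j + 1).toNat := by
  rintro _ ⟨h, ⟨hh, -⟩, rfl⟩
  by_cases h0 : h = 0
  · simp [h0]
  have h1 := hh h0
  have h2 : (lineMap c h).natDegree ≤ h.totalDegree * 1 := by
    refine MvPolynomial.aeval_natDegree_le h le_rfl _ fun i => ?_
    fin_cases i <;> simp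
  rw [Polynomial.mem_degreeLT]
  refine (Polynomial.degree_le_natDegree).trans_lt ?_
  have : (lineMap c h).natDegree < (j + 1).toNat := by omega
  exact_mod_cast this

theorem finrank_degreeLT (n : ℕ) : Module.finrank K (Polynomial.degreeLT K n) = n := by
  rw [(Polynomial.degreeLTEquiv K n).finrank_eq]
  simp

theorem rk_le [Infinite K] (Z : Multiset ((K × K) × ℕ)) (j : ℤ) : rk Z j ≤ max 0 (j + 1) := by
  obtain ⟨c, hc⟩ := exists_notMem_line Z
  rw [← finrank_lineSys hc]
  have : FiniteDimensional K (Polynomial.degreeLT K (j + 1).toNat) :=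
    (Polynomial.degreeLTEquiv K _).symm.finiteDimensional
  have h := Submodule.finrank_mono (lineSys_le_degreeLT c Z j)
  rw [finrank_degreeLT] at h
  omega

/-- The ranks on a line grow strictly once they are positive: a finite dimensional space of
polynomials in one variable is not stable under multiplication by the variable. -/
theorem rk_add_one_le [Infinite K] {Z : Multiset ((K × K) × ℕ)} {j : ℤ} (h : 1 ≤ rk Z j) :
    rk Z j + 1 ≤ rk Z (j + 1) := by
  obtain ⟨c, hc⟩ := exists_notMem_line Z
  rw [← finrank_lineSys hc] at h
  rw [← finrank_lineSys hc, ← finrank_lineSys hc]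
  have hle : lineSys c Z j ≤ lineSys c Z (j + 1) :=
    Submodule.map_mono fun f hf => ⟨fun h0 => (hf.1 h0).trans (by omega), hf.2⟩
  have hX : ∀ f ∈ lineSys c Z j, Polynomial.X * f ∈ lineSys c Z (j + 1) := by
    rintro _ ⟨f, ⟨hf, hf'⟩, rfl⟩
    refine ⟨X 1 * f, ⟨fun h0 => ?_, fun z hz => ?_⟩, by simp [lineMap]⟩
    · have h1 := totalDegree_mul (X 1) f
      have h2 := hf (right_ne_zero_of_mul h0)
      rw [totalDegree_X] at h1
      omega
    · rw [map_mul]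
      exact Dvd.dvd.mul_left (hf' z hz) _
  by_contra hlt
  have heq : lineSys c Z j = lineSys c Z (j + 1) :=
    Submodule.eq_of_le_of_finrank_le hle (by omega)
  have hne : lineSys c Z j ≠ ⊥ := by
    rintro h0
    rw [h0] at h
    simp at h
  obtain ⟨f, hf, hf0⟩ := Submodule.exists_mem_ne_zero_of_ne_bot hne
  have hpow : ∀ n : ℕ, Polynomial.X ^ n * f ∈ lineSys c Z j := by
    intro n
    induction n with
    | zero => simpa using hf
    | succ n ih =>
      rw [pow_succ', mul_assoc, heq]
      exact hX _ ih
  have h1 := Polynomial.mem_degreeLT.1 (lineSys_le_degreeLT c Z j (hpow (j + 1).toNat))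
  rw [Polynomial.degree_mul, Polynomial.degree_X_pow, Polynomial.degree_eq_natDegree hf0] at h1
  have h2 : (j + 1).toNat + f.natDegree < (j + 1).toNat := by exact_mod_cast h1
  omega

theorem dim_eq_zero_of_rk_eq_zero [Infinite K] {Z : Multiset ((K × K) × ℕ)} {j : ℤ}
    (h : rk Z j = 0) : dim Z j = 0 := by
  have key : ∀ n : ℕ, ∀ j : ℤ, j < n → rk Z j = 0 → dim Z j = 0 := by
    intro n
    induction n with
    | zero => exact fun j hj _ => dim_eq_zero Z (by simpa using hj)
    | succ n ih =>
      intro j hj h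
      have h1 : rk Z (j - 1) = 0 := by
        by_contra hne
        have h2 := rk_nonneg Z (j - 1)
        have h3 := rk_add_one_le (Z := Z) (j := j - 1) (by omega)
        rw [sub_add_cancel] at h3
        omega
      have h2 := ih (j - 1) (by push_cast at hj; omega) h1
      rw [rk] at h
      omega
  exact key (j + 1).toNat j (by omega) h

theorem rk_zero [Infinite K] {j : ℤ} (hj : -1 ≤ j) :
    rk (0 : Multiset ((K × K) × ℕ)) j = j + 1 := by
  refine le_antisymm ((rk_le _ j).trans (by omega)) ?_
  have h0 : (∀ z ∈ (0 : Multiset ((K × K) × ℕ)), z.1.1 ≠ (0 : K)) := by simp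
  rw [← finrank_lineSys h0]
  have h : Polynomial.degreeLT K (j + 1).toNat ≤ lineSys (0 : K) 0 j := by
    classical
    rw [Polynomial.degreeLT_eq_span_X_pow, Submodule.span_le]
    intro f hf
    simp only [Finset.coe_image, Finset.coe_range, Set.mem_image, Set.mem_Iio] at hf
    obtain ⟨i, hi, rfl⟩ := hf
    refine ⟨X 1 ^ i, ⟨fun _ => ?_, by simp⟩, by simp [lineMap]⟩
    rw [totalDegree_X_pow]
    omega
  have h1 := Submodule.finrank_mono h
  rw [finrank_degreeLT] at h1
  omega

theorem two_mul_dim_zero [Infinite K] {j : ℤ} (hj : -2 ≤ j) :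
    2 * dim (0 : Multiset ((K × K) × ℕ)) j = (j + 1) * (j + 2) := by
  obtain ⟨n, rfl⟩ : ∃ n : ℕ, j = n - 2 := ⟨(j + 2).toNat, by omega⟩
  clear hj
  induction n with
  | zero => rw [dim_eq_zero _ (by simp)]; simp
  | succ n ih =>
    have h := rk_zero (K := K) (j := ((n + 1 : ℕ) : ℤ) - 2) (by push_cast; omega)
    rw [rk, show ((n + 1 : ℕ) : ℤ) - 2 - 1 = n - 2 by push_cast; ring] at h
    have h2 : dim (0 : Multiset ((K × K) × ℕ)) (((n + 1 : ℕ) : ℤ) - 2) =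
      dim (0 : Multiset ((K × K) × ℕ)) ((n : ℤ) - 2) + (((n + 1 : ℕ) : ℤ) - 2 + 1) := by omega
    rw [h2, mul_add, ih]
    push_cast
    ring

end Rank

/-! ### The number of conditions imposed by a point -/

section Conditions

/-- The translation `h(x) ↦ h(p + x)`. -/
def translate (p : K × K) : MvPolynomial (Fin 2) K →ₐ[K] MvPolynomial (Fin 2) K :=
  aeval ![X 0 + C p.1, X 1 + C p.2]

theorem translate_zero : translate (0 : K × K) = AlgHom.id K _ := by
  refine algHom_ext fun i => ?_
  fin_cases i <;> simp [translate]

/-- The exponents of the monomials of degree less than `d` in two variables; these index the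
conditions imposed by a point of multiplicity `d`. -/
abbrev Cond (d : ℕ) : Type := Σ i : Fin d, Fin (i + 1)

/-- The exponent that corresponds to an index in `Cond d`. -/
def Cond.exponent {d : ℕ} (x : Cond d) : Fin 2 →₀ ℕ :=
  Finsupp.single 0 (x.2 : ℕ) + Finsupp.single 1 ((x.1 : ℕ) - x.2)

theorem card_cond (d : ℕ) : Fintype.card (Cond d) = d * (d + 1) / 2 := by
  rw [Fintype.card_sigma]
  simp only [Fintype.card_fin]
  rw [Fin.sum_univ_eq_sum_range (fun i => i + 1) d, ← add_zero (∑ i ∈ Finset.range d, (i + 1)),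
    ← Finset.sum_range_succ' (fun i => i) d, Finset.sum_range_id, Nat.add_sub_cancel, mul_comm]

theorem coeff_taylorAt (p : K × K) (h : MvPolynomial (Fin 2) K) (n : ℕ) :
    (taylorAt p h).coeff n = homogeneousComponent n (translate p h) := by
  let S : MvPolynomial (Fin 2) K →ₐ[K] Polynomial (MvPolynomial (Fin 2) K) :=
    aeval fun i => Polynomial.X * Polynomial.C (X i)
  have h1 : taylorAt p = S.comp (translate p) := by
    refine algHom_ext fun i => ?_
    fin_cases i <;> simp [S, translate, taylorAt, MvPolynomial.algebraMap_eq]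
  have h2 : ∀ g, (S g).coeff n = homogeneousComponent n g := by
    intro g
    induction g using MvPolynomial.induction_on' with
    | monomial m a =>
      have h3 : S (monomial m a) = Polynomial.monomial m.degree (monomial m a) := by
        simp only [S, aeval_monomial, mul_pow, Finsupp.prod_mul]
        rw [monomial_eq, ← Polynomial.C_mul_X_pow_eq_monomial]
        simp only [Finsupp.prod, Finset.prod_pow_eq_pow_sum, Finsupp.degree_apply,
          Polynomial.C_mul, map_prod, Polynomial.C_pow, Polynomial.algebraMap_apply,
          MvPolynomial.algebraMap_eq]
        ring
      rw [h3, Polynomial.coeff_monomial]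
      split_ifs with h4
      · rw [homogeneousComponent_of_mem (isHomogeneous_monomial a rfl), if_pos h4.symm]
      · rw [homogeneousComponent_of_mem (isHomogeneous_monomial a rfl), if_neg (Ne.symm h4)]
    | add p q hp hq => rw [map_add, map_add, Polynomial.coeff_add, hp, hq]
  rw [h1, AlgHom.comp_apply, h2]

theorem forall_cond_iff {g : MvPolynomial (Fin 2) K} {d : ℕ} :
    (∀ x : Cond d, coeff x.exponent g = 0) ↔ g ∈ idealOfVars (Fin 2) K ^ d := by
  rw [mem_pow_idealOfVars_iff']
  constructor
  · intro H m hm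
    rw [Finsupp.degree_eq_sum, Fin.sum_univ_two] at hm
    have h2 := H ⟨⟨m 0 + m 1, hm⟩, ⟨m 0, by simp only []; omega⟩⟩
    rwa [show Cond.exponent ⟨⟨m 0 + m 1, hm⟩, ⟨m 0, by simp only []; omega⟩⟩ = m by
      ext i; fin_cases i <;> simp [Cond.exponent]] at h2
  · intro H x
    refine H _ ?_
    have := x.2.2
    have := x.1.2
    simp only [Cond.exponent, map_add, Finsupp.degree_single]
    omega

theorem pow_dvd_taylorAt_iff {p : K × K} {h : MvPolynomial (Fin 2) K} {d : ℕ} :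
    Polynomial.X ^ d ∣ taylorAt p h ↔
      ∀ x : Cond d, coeff x.exponent (translate p h) = 0 := by
  rw [forall_cond_iff, mem_pow_idealOfVars_iff', Polynomial.X_pow_dvd_iff]
  simp only [coeff_taylorAt]
  constructor
  · intro H m hm
    have h1 := congrArg (coeff m) (H m.degree hm)
    rwa [coeff_homogeneousComponent, if_pos rfl, coeff_zero] at h1
  · intro H n hn
    ext m
    rw [coeff_homogeneousComponent, coeff_zero]
    split_ifs with h1
    · exact H m (h1 ▸ hn)
    · rfl

/-- The conditions for vanishing to order `d` at `p`. -/
def condMap (p : K × K) (d : ℕ) : MvPolynomial (Fin 2) K →ₗ[K] (Cond d → K) :=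
  LinearMap.pi fun x => (lcoeff K x.exponent).comp (translate p).toLinearMap

theorem mem_ker_condMap {p : K × K} {d : ℕ} {h : MvPolynomial (Fin 2) K} :
    h ∈ LinearMap.ker (condMap p d) ↔ Polynomial.X ^ d ∣ taylorAt p h := by
  rw [pow_dvd_taylorAt_iff, LinearMap.mem_ker, funext_iff]
  rfl

theorem dim_le_dim_cons_add (z : (K × K) × ℕ) (Z : Multiset ((K × K) × ℕ)) (j : ℤ) :
    dim Z j ≤ dim (z ::ₘ Z) j + (z.2 * (z.2 + 1) / 2 : ℕ) := by
  have h := finrank_le_finrank_inf_ker_add (condMap z.1 z.2) (linSys Z j)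
  have h2 : linSys Z j ⊓ LinearMap.ker (condMap z.1 z.2) ≤ linSys (z ::ₘ Z) j := by
    rintro f ⟨⟨hf, hf'⟩, hk⟩
    refine ⟨hf, fun y hy => ?_⟩
    rcases Multiset.mem_cons.1 hy with rfl | hy
    · exact mem_ker_condMap.1 hk
    · exact hf' y hy
  have h3 := Submodule.finrank_mono h2
  rw [Module.finrank_fintype_fun_eq_card, card_cond] at h
  rw [dim, dim]
  omega

end Conditions

/-! ### Expected dimensions and single points -/

/-- The number of conditions `∑ d (d + 1) / 2` expected from points of the given
multiplicities. -/
def size (S : Multiset ℕ) : ℤ := (S.map fun d => ((d * (d + 1) / 2 : ℕ) : ℤ)).sum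

theorem size_zero : size 0 = 0 := rfl

theorem size_cons (d : ℕ) (S : Multiset ℕ) :
    size (d ::ₘ S) = ((d * (d + 1) / 2 : ℕ) : ℤ) + size S := by
  simp only [size, Multiset.map_cons, Multiset.sum_cons]

theorem size_add (S S' : Multiset ℕ) : size (S + S') = size S + size S' := by
  simp only [size, Multiset.map_add, Multiset.sum_add]

theorem size_nonneg (S : Multiset ℕ) : 0 ≤ size S := by
  induction S using Multiset.induction_on with
  | empty => rfl
  | cons a S ih => rw [size_cons]; omega

theorem size_replicate (n d : ℕ) :
    size (Multiset.replicate n d) = n * ((d * (d + 1) / 2 : ℕ) : ℤ) := by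
  simp [size]

theorem two_mul_triangle (d : ℕ) : 2 * ((d * (d + 1) / 2 : ℕ) : ℤ) = d * (d + 1) := by
  have h : 2 * (d * (d + 1) / 2) = d * (d + 1) :=
    Nat.mul_div_cancel' (Nat.even_mul_succ_self d).two_dvd
  exact_mod_cast h

theorem dim_le_dim_add (Z Q : Multiset ((K × K) × ℕ)) (j : ℤ) :
    dim Z j ≤ dim (Z + Q) j + size (Q.map Prod.snd) := by
  induction Q using Multiset.induction_on with
  | empty => simp [size_zero]
  | cons z Q ih =>
    have h := dim_le_dim_cons_add z (Z + Q) j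
    rw [Multiset.add_cons, Multiset.map_cons, size_cons]
    omega

theorem dim_zero_le (Z : Multiset ((K × K) × ℕ)) (j : ℤ) :
    dim (0 : Multiset ((K × K) × ℕ)) j ≤ dim Z j + size (Z.map Prod.snd) := by
  simpa using dim_le_dim_add 0 Z j

theorem dim_mono [Infinite K] (Z : Multiset ((K × K) × ℕ)) {i j : ℤ} (h : i ≤ j) :
    dim Z i ≤ dim Z j :=
  Int.ofNat_le.2 (Submodule.finrank_mono fun _ hf => ⟨fun h0 => (hf.1 h0).trans h, hf.2⟩)

theorem rk_add_le [Infinite K] {Z : Multiset ((K × K) × ℕ)} {j : ℤ} (h : 1 ≤ rk Z j) (i : ℕ) :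
    rk Z j + i ≤ rk Z (j + i) := by
  induction i with
  | zero => simp
  | succ i ih =>
    have := rk_add_one_le (Z := Z) (j := j + i) (by omega)
    push_cast
    rw [← add_assoc j]
    omega

theorem one_le_rk [Infinite K] {Z : Multiset ((K × K) × ℕ)} {j : ℤ} (h : 0 < dim Z j) :
    1 ≤ rk Z j := by
  by_contra hlt
  have h1 := rk_nonneg Z j
  have h2 := dim_eq_zero_of_rk_eq_zero (Z := Z) (j := j) (by omega)
  omega

theorem rk_sub_one_lt [Infinite K] {Z : Multiset ((K × K) × ℕ)} {j : ℤ} (h : 0 < dim Z j) :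
    rk Z (j - 1) + 1 ≤ rk Z j := by
  have h1 := one_le_rk h
  have h2 := rk_nonneg Z (j - 1)
  by_cases h3 : rk Z (j - 1) = 0
  · omega
  · have := rk_add_one_le (Z := Z) (j := j - 1) (by omega)
    rwa [sub_add_cancel] at this

theorem three_le_rk [Infinite K] {Z : Multiset ((K × K) × ℕ)} {j : ℤ} (h : 4 ≤ dim Z j) :
    3 ≤ rk Z j := by
  by_contra hlt
  have e1 : dim Z j = rk Z j + dim Z (j - 1) := by rw [rk]; ring
  have e2 : dim Z (j - 1) = rk Z (j - 1) + dim Z (j - 1 - 1) := by rw [rk]; ring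
  have h1 : rk Z (j - 1) + 1 ≤ rk Z j := rk_sub_one_lt (by omega)
  have h2 : rk Z (j - 1 - 1) + 1 ≤ rk Z (j - 1) := rk_sub_one_lt (by omega)
  have h3 := rk_nonneg Z (j - 1 - 1)
  have h4 := dim_eq_zero_of_rk_eq_zero (Z := Z) (j := j - 1 - 1) (by omega)
  omega

theorem sum_rk_add_dim (Z : Multiset ((K × K) × ℕ)) (j : ℤ) (n : ℕ) :
    ∑ b ∈ Finset.range n, rk Z (j - b) + dim Z (j - n) = dim Z j := by
  induction n with
  | zero => simp
  | succ n ih =>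
    rw [Finset.sum_range_succ, rk, ← ih]
    push_cast
    rw [sub_sub]
    ring

theorem two_mul_sum_range (a i : ℕ) :
    2 * ∑ b ∈ Finset.range a, ((a : ℤ) + i - b) = a * (a + 1) + 2 * a * i := by
  rw [Finset.mul_sum]
  have : ∀ n : ℕ, ∑ b ∈ Finset.range n, 2 * ((a : ℤ) + i - b) = 2 * n * (a + i) - n * (n - 1) := by
    intro n
    induction n with
    | zero => simp
    | succ n ih => rw [Finset.sum_range_succ, ih]; push_cast; ring
  rw [this]
  ring

/-- A suitably chosen point of multiplicity `a + i` imposes, in each degree `j ≤ T` in which the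
first `a` ranks are large enough, all but at most `i (i + 1) / 2` of the expected conditions, and
it imposes at least one condition on every nonzero system. -/
theorem exists_point [CharZero K] (Z : Multiset ((K × K) × ℕ)) (d T : ℕ) :
    ∃ Q : Multiset ((K × K) × ℕ), Q.map Prod.snd = {d} ∧
      (∀ j : ℤ, j ≤ T → ∀ a i : ℕ, a + i = d → (∀ b < a, (d : ℤ) - b ≤ rk Z (j - b)) →
        2 * dim (Z + Q) j ≤ 2 * dim Z j - d * (d + 1) + i * (i + 1)) ∧
      ∀ j : ℤ, j ≤ T → 1 ≤ d → 0 < dim Z j → dim (Z + Q) j < dim Z j := by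
  obtain ⟨Q, hQ, h⟩ := exists_batch Z 1 d T
  refine ⟨Q, hQ, fun j hj a i hd hr => ?_, fun j hj hd hpos => ?_⟩
  swap
  · obtain ⟨n, rfl⟩ : ∃ n, d = n + 1 := ⟨d - 1, by omega⟩
    have h1 := h j hj
    have h2 := sum_rk_add_dim Z j (n + 1)
    rw [Finset.sum_range_succ'] at h1 h2
    have h3 : ∑ b ∈ Finset.range n,
        max 0 (rk Z (j - (b + 1 : ℕ)) - (1 : ℕ) * (((n + 1 : ℕ) : ℤ) - (b + 1 : ℕ))) ≤
          ∑ b ∈ Finset.range n, rk Z (j - (b + 1 : ℕ)) := by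
      refine Finset.sum_le_sum fun b hb => ?_
      have hb' := Finset.mem_range.1 hb
      have := rk_nonneg Z (j - (b + 1 : ℕ))
      push_cast at *
      omega
    have h4 := one_le_rk hpos
    simp only [Nat.cast_zero, sub_zero, Nat.cast_one, one_mul] at *
    push_cast at *
    omega
  subst hd
  have h1 := h j hj
  rw [Finset.sum_range_add] at h1
  have h2 : ∑ b ∈ Finset.range a, max 0 (rk Z (j - b) - (1 : ℕ) * (((a + i : ℕ) : ℤ) - b)) =
      ∑ b ∈ Finset.range a, rk Z (j - b) - ∑ b ∈ Finset.range a, ((a : ℤ) + i - b) := by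
    rw [← Finset.sum_sub_distrib]
    refine Finset.sum_congr rfl fun b hb => ?_
    have := hr b (Finset.mem_range.1 hb)
    push_cast at this ⊢
    rw [one_mul, max_eq_right (by omega)]
  have h3 : ∑ b ∈ Finset.range i,
      max 0 (rk Z (j - (a + b : ℕ)) - (1 : ℕ) * (((a + i : ℕ) : ℤ) - (a + b : ℕ))) ≤
        ∑ b ∈ Finset.range i, rk Z (j - a - b) := by
    refine Finset.sum_le_sum fun b hb => ?_
    have hb' := Finset.mem_range.1 hb
    have e : j - ((a + b : ℕ) : ℤ) = j - a - b := by push_cast; ring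
    rw [e]
    have := rk_nonneg Z (j - a - b)
    push_cast
    omega
  have h4 := sum_rk_add_dim Z j a
  have h5 := sum_rk_add_dim Z (j - a) i
  have h6 := two_mul_sum_range a i
  have h7 : j - ((a + i : ℕ) : ℤ) = j - a - i := by push_cast; ring
  rw [h7] at h1
  push_cast at *
  nlinarith

/-- The effect of a suitably chosen double point on the dimensions. -/
theorem exists_double_point [CharZero K] (Z : Multiset ((K × K) × ℕ)) (T : ℕ) :
    ∃ Q : Multiset ((K × K) × ℕ), Q.map Prod.snd = {2} ∧ ∀ j : ℤ, j ≤ T →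
      dim Z j - 3 ≤ dim (Z + Q) j ∧ dim (Z + Q) j ≤ dim Z j ∧
      (0 < dim Z (j - 1) → dim (Z + Q) j = dim Z j - 3) ∧
      dim (Z + Q) j ≤ max 0 (dim Z j - 2) := by
  obtain ⟨Q, hQ, h⟩ := exists_batch Z 1 2 T
  refine ⟨Q, hQ, fun j hj => ?_⟩
  have h1 := h j hj
  simp only [Finset.sum_range_succ, Finset.sum_range_zero] at h1
  have h2 := dim_le_dim_add Z Q j
  rw [hQ, show size (Multiset.replicate 1 2) = 3 from rfl] at h2
  have h3 := dim_anti (Multiset.le_add_right Z Q) j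
  have h4 := dim_nonneg Z (j - 1)
  have e1 : dim Z j = rk Z j + dim Z (j - 1) := by rw [rk]; ring
  have e2 : dim Z (j - 1) = rk Z (j - 1) + dim Z (j - 2) := by
    rw [rk, show j - 1 - 1 = j - 2 by ring]; ring
  have h5 := rk_nonneg Z j
  have h6 := rk_nonneg Z (j - 1)
  push_cast at h1
  simp only [sub_zero] at h1
  have h7 : 0 < dim Z (j - 1) → dim (Z + Q) j = dim Z j - 3 := by
    intro hpos
    have h8 := one_le_rk hpos
    have h9 := rk_add_one_le (Z := Z) (j := j - 1) h8
    rw [sub_add_cancel] at h9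
    omega
  refine ⟨by omega, h3, h7, ?_⟩
  by_cases hpos : 0 < dim Z (j - 1)
  · have := h7 hpos
    omega
  · have := dim_nonneg Z (j - 2)
    omega

/-! ### Points of multiplicity at least three -/

/-- Points of multiplicity at least three, added one by one, impose all conditions in degree
`t - 1`. The hypothesis `hroom` makes the ranks at every step so large that the trace of a new point of
multiplicity `d` fails to be independent only where the system of degree `t - d - 1`
(for degree `t - 2`) or `t - d - 2` (for degree `t - 3`) is zero. As a zero system has at least as
many conditions as there are polynomials, few points can be added after that, and this bounds the
numbers of conditions lost in the degrees `t - 2` and `t - 3`. -/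
theorem exists_points_three_le [CharZero K] (t m : ℕ) (A : Multiset ℕ)
    (hA : ∀ d ∈ A, 3 ≤ d ∧ d ≤ m)
    (hroom : ∀ d A', d ::ₘ A' ≤ A → size A' + 4 ≤ dim (K := K) 0 (t - d)) :
    ∃ Z : Multiset ((K × K) × ℕ), Z.map Prod.snd = A ∧
      dim Z (t - 1) = dim (K := K) 0 (t - 1) - size A ∧
      (dim Z (t - 2) = dim (K := K) 0 (t - 2) - size A ∨ dim Z (t - m - 1) = 0 ∧
        6 * (dim Z (t - 2) - (dim (K := K) 0 (t - 2) - size A)) ≤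
          size A - dim (K := K) 0 (t - m - 1)) ∧
      (0 < dim Z (t - 4) → dim Z (t - 3) = dim (K := K) 0 (t - 3) - size A ∨
        (m ≤ 3 ∧ 6 * (dim Z (t - 3) - (dim (K := K) 0 (t - 3) - size A)) ≤
          size A - dim (K := K) 0 (t - 5)) ∨
        (4 ≤ m ∧ 10 * (dim Z (t - 3) - (dim (K := K) 0 (t - 3) - size A)) ≤
          3 * (size A - dim (K := K) 0 (t - m - 2)))) := by
  induction A using Multiset.induction_on with
  | empty => exact ⟨0, rfl, by simp [size_zero], Or.inl (by simp [size_zero]),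
      fun _ => Or.inl (by simp [size_zero])⟩
  | cons d A ih =>
    obtain ⟨Z, hZ, h1, h2, h3⟩ := ih (fun d hd => hA d (Multiset.mem_cons_of_mem hd))
      (fun d A' h => hroom d A' (h.trans (Multiset.le_cons_self _ _)))
    obtain ⟨hd3, hdm⟩ := hA d (Multiset.mem_cons_self d A)
    obtain ⟨Q, hQ, hp, hlt⟩ := exists_point Z d t
    have hroom' := hroom d A le_rfl
    have hexp := fun j : ℤ => dim_zero_le Z j
    simp only [hZ] at hexp
    have hr3 : 3 ≤ rk Z (t - d) := three_le_rk (by have := hexp (t - d); omega)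
    have hgrow : ∀ i : ℕ, 3 + (i : ℤ) ≤ rk Z (t - d + i) := fun i => by
      have := rk_add_le (Z := Z) (j := (t : ℤ) - d) (by omega) i
      omega
    have hgrow' : ∀ j : ℤ, (t : ℤ) - d ≤ j → 3 + (j - (t - d)) ≤ rk Z j := fun j hj => by
      have := hgrow (j - (t - d)).toNat
      rw [Int.toNat_of_nonneg (by omega)] at this
      rwa [show (t : ℤ) - d + (j - (t - d)) = j by ring] at this
    have hlow : ∀ j : ℤ, dim Z j - ((d * (d + 1) / 2 : ℕ) : ℤ) ≤ dim (Z + Q) j := fun j => by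
      have := dim_le_dim_add Z Q j
      rw [hQ, show ({d} : Multiset ℕ) = d ::ₘ 0 from rfl, size_cons, size_zero] at this
      omega
    have htri := two_mul_triangle d
    have hmono := fun j : ℤ => dim_anti (Multiset.le_add_right Z Q) j
    have hnn := fun j : ℤ => dim_nonneg (Z + Q) j
    have hdd : (6 : ℤ) ≤ ((d * (d + 1) / 2 : ℕ) : ℤ) := by nlinarith
    -- no condition is lost in degree `t - 1`
    have e1 := hp (t - 1) (by omega) d 0 rfl fun b hb => by
      have := hgrow' ((t : ℤ) - 1 - b) (by omega)
      omega
    -- at most one condition is lost in degree `t - 2`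
    have e2 := hp (t - 2) (by omega) (d - 1) 1 (by omega) fun b hb => by
      have := hgrow' ((t : ℤ) - 2 - b) (by omega)
      omega
    have e2' : 0 < dim Z (t - d - 1) → _ := fun hpos => hp (t - 2) (by omega) d 0 rfl fun b hb => by
      by_cases hb' : b = d - 1
      · have h5 := one_le_rk hpos
        rw [show (t : ℤ) - 2 - b = t - d - 1 by omega]
        omega
      · have := hgrow' ((t : ℤ) - 2 - b) (by omega)
        omega
    -- at most three conditions are lost in degree `t - 3`
    have e3 := hp (t - 3) (by omega) (d - 2) 2 (by omega) fun b hb => by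
      have := hgrow' ((t : ℤ) - 3 - b) (by omega)
      omega
    have e3' : 0 < dim Z (t - d - 2) → _ := fun hpos => hp (t - 3) (by omega) d 0 rfl fun b hb => by
      have h5 := one_le_rk hpos
      have h6 := rk_add_one_le h5
      by_cases hb' : b = d - 1
      · rw [show (t : ℤ) - 3 - b = t - d - 2 by omega]
        omega
      by_cases hb2 : b = d - 2
      · rw [show (t : ℤ) - 3 - b = t - d - 2 + 1 by omega]
        omega
      · have := hgrow' ((t : ℤ) - 3 - b) (by omega)
        omega
    have e3'' : d = 3 → 0 < dim (Z + Q) (t - 4) → _ := fun hd hpos =>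
      hp (t - 3) (by omega) 2 1 (by omega) fun b hb => by
        have h5 := hlt (t - 4) (by omega) (by omega) (by have := hmono (t - 4); omega)
        have h6 := rk_sub_one_lt (Z := Z) (j := (t : ℤ) - 4) (by omega)
        have h7 : 2 ≤ rk Z (t - 4) := by
          by_contra hlt2
          have h8 := rk_nonneg Z ((t : ℤ) - 4 - 1)
          have h9 := dim_eq_zero_of_rk_eq_zero (Z := Z) (j := (t : ℤ) - 4 - 1) (by omega)
          have h10 : rk Z ((t : ℤ) - 4) = dim Z (t - 4) - dim Z (t - 4 - 1) := rfl
          omega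
        by_cases hb' : b = 1
        · rw [show (t : ℤ) - 3 - b = t - 4 by omega]
          omega
        · have := hgrow' ((t : ℤ) - 3 - b) (by omega)
          omega
    push_cast at e1 e2 e2' e3 e3' e3''
    refine ⟨Z + Q, by rw [Multiset.map_add, hZ, hQ, add_comm]; rfl, ?_, ?_, ?_⟩
    · have := hlow (t - 1)
      rw [size_cons]
      omega
    · have l2 := hlow (t - 2)
      have k1 := dim_mono Z (i := (t : ℤ) - m - 1) (j := t - d - 1) (by omega)
      have k2 := dim_mono (K := K) 0 (i := (t : ℤ) - m - 1) (j := t - d - 1) (by omega)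
      have k3 := hmono (t - m - 1)
      have k4 := hexp (t - d - 1)
      have k5 := hnn (t - m - 1)
      have k6 := dim_nonneg Z (t - d - 1)
      rw [size_cons]
      by_cases hpos : 0 < dim Z (t - d - 1)
      · have := e2' hpos
        omega
      · right
        omega
    · intro hpos
      have h3' := h3 (lt_of_lt_of_le hpos (hmono _))
      have l3 := hlow (t - 3)
      have k2 := dim_mono (K := K) 0 (i := (t : ℤ) - m - 2) (j := t - d - 2) (by omega)
      have k4 := hexp (t - d - 2)
      have k6 := dim_nonneg Z (t - d - 2)
      rw [size_cons]
      by_cases hpos' : 0 < dim Z (t - d - 2)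
      · have := e3' hpos'
        omega
      · by_cases hd : d = 3
        · have e4 := e3'' hd hpos
          subst hd
          rw [show (t : ℤ) - (3 : ℕ) - 2 = t - 5 by omega] at *
          right
          rcases Nat.lt_or_ge 3 m with hm | hm
          · right
            omega
          · left
            omega
        · have hdd' : (10 : ℤ) ≤ ((d * (d + 1) / 2 : ℕ) : ℤ) := by
            have : (4 : ℤ) ≤ d := by omega
            nlinarith
          right; right
          omega

/-! ### Double points -/

/-- The growth of the ranks, in terms of dimensions. -/
theorem dim_growth [Infinite K] {Z : Multiset ((K × K) × ℕ)} {j : ℤ} (i k : ℤ) (hi : i = j - 1)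
    (hk : k = j - 2) (h : 0 < dim Z j) :
    dim Z i - dim Z k + 1 ≤ dim Z j - dim Z i := by
  subst hi hk
  have h1 := rk_sub_one_lt h
  rw [rk, rk, show j - 1 - 1 = j - 2 by ring] at h1
  exact h1

/-- The effect of a suitably chosen batch of double points on the dimensions. -/
theorem exists_double_batch [CharZero K] (Z : Multiset ((K × K) × ℕ)) (q T : ℕ) :
    ∃ Q : Multiset ((K × K) × ℕ), Q.map Prod.snd = Multiset.replicate q 2 ∧
      ∀ j i k : ℤ, j ≤ T → i = j - 1 → k = j - 2 →
        dim Z j - 3 * q ≤ dim (Z + Q) j ∧ dim (Z + Q) j ≤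
          max 0 (dim Z j - dim Z i - 2 * q) + max 0 (dim Z i - dim Z k - q) + dim Z k := by
  obtain ⟨Q, hQ, h⟩ := exists_batch Z q 2 T
  refine ⟨Q, hQ, fun j i k hj hi hk => ⟨?_, ?_⟩⟩
  · have := dim_le_dim_add Z Q j
    rw [hQ, size_replicate] at this
    norm_num at this
    omega
  · have h1 := h j hj
    simp only [Finset.sum_range_succ, Finset.sum_range_zero, rk] at h1
    subst hi hk
    push_cast at h1
    rw [sub_zero, show j - 1 - 1 = j - 2 by ring] at h1
    omega

/-- Two batches of double points on two lines complete a configuration whose dimensions in the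
degrees `t - 1, …, t - 4` are suitably balanced: after the batch of `q` points the dimension is
`q₁ + w` in degree `t - 1` and at most `w` in degree `t - 2`, so the batch of `q₁` points imposes
all its conditions in degree `t` on the residual side, and at most `ε` dimensions remain on the
line, whose rank in degree `t` is at most `t + 1 = 2 q₁ + ε`. -/
theorem exists_two_batches [CharZero K] {t q q₁ : ℕ} {w ε : ℤ} {Z : Multiset ((K × K) × ℕ)}
    (ht : (t : ℤ) + 1 = 2 * q₁ + ε) (hε : 0 ≤ ε)
    (h1 : dim Z (t - 1) = q₁ + w + 3 * q) (hr1 : 2 * (q : ℤ) ≤ dim Z (t - 1) - dim Z (t - 2))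
    (hr2 : (q : ℤ) ≤ dim Z (t - 2) - dim Z (t - 3))
    (hT : max 0 (dim Z (t - 2) - dim Z (t - 3) - 2 * q) +
      max 0 (dim Z (t - 3) - dim Z (t - 4) - q) + dim Z (t - 4) ≤ w) :
    ∃ Q : Multiset ((K × K) × ℕ), Q.map Prod.snd = Multiset.replicate (q + q₁) 2 ∧
      dim (Z + Q) t ≤ w + ε := by
  obtain ⟨Q, hQ, h⟩ := exists_double_batch Z q t
  obtain ⟨Q', hQ', h'⟩ := exists_double_batch (Z + Q) q₁ t
  refine ⟨Q + Q', by rw [Multiset.map_add, hQ, hQ', ← Multiset.replicate_add], ?_⟩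
  have a1 := h (t - 1) (t - 2) (t - 3) (by omega) (by omega) (by omega)
  have a2 := h (t - 2) (t - 3) (t - 4) (by omega) (by omega) (by omega)
  have a3 := (h' t (t - 1) (t - 2) (by omega) (by omega) (by omega)).2
  have a4 : rk (Z + Q) t ≤ max 0 (t + 1) := rk_le _ _
  rw [rk] at a4
  rw [← add_assoc]
  omega

/-- If `q` double points are still to be added, they are added one by one until the rank in degree
`t - 1` is at least twice the number of the remaining ones, so that a line can take these. Up to
then the rank is so small that the system of degree `t - 2` is nonzero, and each double point
imposes three conditions in degree `t - 1`. -/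
theorem exists_descent [CharZero K] {t : ℕ} {M : ℤ} (hM : 0 ≤ M) (q : ℕ) :
    ∀ Z : Multiset ((K × K) × ℕ), dim Z (t - 1) = M + 3 * q →
    ∃ (Q : Multiset ((K × K) × ℕ)) (k q' : ℕ), Q.map Prod.snd = Multiset.replicate k 2 ∧
      k + q' = q ∧ dim (Z + Q) (t - 1) = M + 3 * q' ∧
      2 * (q' : ℤ) ≤ dim (Z + Q) (t - 1) - dim (Z + Q) (t - 2) ∧
      (k = 0 ∨ dim (Z + Q) (t - 1) - dim (Z + Q) (t - 2) ≤ 2 * q' + 1) ∧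
      (0 < dim (Z + Q) (t - 3) → dim (Z + Q) (t - 1) - dim (Z + Q) (t - 2) =
        dim Z (t - 1) - dim Z (t - 2)) ∧
      (0 < dim (Z + Q) (t - 4) → dim (Z + Q) (t - 2) - dim (Z + Q) (t - 3) =
        dim Z (t - 2) - dim Z (t - 3)) ∧
      dim (Z + Q) (t - 4) ≤ max 0 (dim Z (t - 4) - 2 * k) := by
  induction q with
  | zero =>
    intro Z h
    refine ⟨0, 0, 0, rfl, rfl, by simpa using h, ?_, Or.inl rfl, by simp, by simp, ?_⟩
    · have := dim_mono Z (i := (t : ℤ) - 2) (j := t - 1) (by omega)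
      simp only [add_zero]
      omega
    · simp
  | succ q ih =>
    intro Z h
    by_cases hr : 2 * ((q + 1 : ℕ) : ℤ) ≤ dim Z (t - 1) - dim Z (t - 2)
    · exact ⟨0, 0, q + 1, rfl, by omega, by simpa using h, by simpa using hr, Or.inl rfl,
        by simp, by simp, by simp⟩
    obtain ⟨Q, hQ, hq⟩ := exists_double_point Z t
    have a1 := hq (t - 1) (by omega)
    have a2 := hq (t - 2) (by omega)
    have a3 := hq (t - 3) (by omega)
    have a4 := hq (t - 4) (by omega)
    rw [show (t : ℤ) - 1 - 1 = t - 2 by omega] at a1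
    rw [show (t : ℤ) - 2 - 1 = t - 3 by omega] at a2
    rw [show (t : ℤ) - 3 - 1 = t - 4 by omega] at a3
    have m2 := dim_mono Z (i := (t : ℤ) - 3) (j := t - 2) (by omega)
    have m3 := dim_mono Z (i := (t : ℤ) - 4) (j := t - 3) (by omega)
    obtain ⟨Q', k, q', hQ', hk, b1, b2, b3, b4, b5, b6⟩ := ih (Z + Q) (by omega)
    rw [add_assoc] at b1 b2 b3 b4 b5 b6
    have c3 := dim_anti (Multiset.le_add_right (Z + Q) Q') (t - 3)
    have c4 := dim_anti (Multiset.le_add_right (Z + Q) Q') (t - 4)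
    rw [add_assoc] at c3 c4
    refine ⟨Q + Q', k + 1, q', ?_, by omega, b1, b2, ?_, fun hpos => ?_, fun hpos => ?_, ?_⟩
    · rw [Multiset.map_add, hQ, hQ', Multiset.replicate_succ]
      rfl
    · right
      rcases b3 with rfl | b3
      · have : Q' = 0 := by simpa using hQ'
        subst this
        rw [add_zero] at *
        omega
      · exact b3
    · have := b4 hpos
      omega
    · have := b5 hpos
      omega
    · push_cast
      omega

/-- Further double points are added one by one until the hypotheses of `exists_two_batches` hold.
The last hypothesis on `Z` is kept at every step: in its first case the rank `ρ` is so large that the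
balance can fail only if the ranks in degree `t - 2` are small and the system of degree `t - 3` is
nonzero; its second case says the same if the system of degree `t - 4` is zero. Thus a step changes
the dimensions in the degrees `t - 1` and `t - 2` by exactly three and leaves `ρ` unchanged. Without
remaining double points the balance holds because `q₁ ≤ ρ`. -/
theorem exists_balance [CharZero K] {t q₁ : ℕ} {w ε ρ : ℤ}
    (ht : (t : ℤ) + 1 = 2 * q₁ + ε) (hε : 0 ≤ ε) (hw : 0 ≤ w) (hρ : (q₁ : ℤ) + 1 ≤ ρ) (q : ℕ) :
    ∀ Z : Multiset ((K × K) × ℕ), dim Z (t - 1) = q₁ + w + 3 * q →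
    dim Z (t - 1) - dim Z (t - 2) = ρ → 2 * (q : ℤ) ≤ ρ →
    (q : ℤ) ≤ dim Z (t - 2) - dim Z (t - 3) →
    ((q₁ : ℤ) + q ≤ ρ ∨ (dim Z (t - 4) = 0 ∧
      (dim Z (t - 3) ≤ q → q₁ + q - ρ ≤ dim Z (t - 3)))) →
    ∃ Q : Multiset ((K × K) × ℕ), Q.map Prod.snd = Multiset.replicate (q + q₁) 2 ∧
      dim (Z + Q) t ≤ w + ε := by
  induction q with
  | zero =>
    intro Z h1 h2 h3 h4 h5
    have m2 := dim_mono Z (i := (t : ℤ) - 3) (j := t - 2) (by omega)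
    have m3 := dim_mono Z (i := (t : ℤ) - 4) (j := t - 3) (by omega)
    refine exists_two_batches ht hε h1 (by omega) h4 ?_
    push_cast at *
    omega
  | succ q ih =>
    intro Z h1 h2 h3 h4 h5
    have m2 := dim_mono Z (i := (t : ℤ) - 3) (j := t - 2) (by omega)
    have m3 := dim_mono Z (i := (t : ℤ) - 4) (j := t - 3) (by omega)
    have m4 := dim_nonneg Z (t - 4)
    by_cases hT : max 0 (dim Z (t - 2) - dim Z (t - 3) - 2 * ((q + 1 : ℕ) : ℤ)) +
      max 0 (dim Z (t - 3) - dim Z (t - 4) - ((q + 1 : ℕ) : ℤ)) + dim Z (t - 4) ≤ w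
    · exact exists_two_batches ht hε h1 (by omega) h4 hT
    obtain ⟨Q, hQ, hq⟩ := exists_double_point Z t
    have a1 := hq (t - 1) (by omega)
    have a2 := hq (t - 2) (by omega)
    have a3 := hq (t - 3) (by omega)
    have a4 := hq (t - 4) (by omega)
    rw [show (t : ℤ) - 1 - 1 = t - 2 by omega] at a1
    rw [show (t : ℤ) - 2 - 1 = t - 3 by omega] at a2
    rw [show (t : ℤ) - 3 - 1 = t - 4 by omega] at a3
    have n4 := dim_nonneg (Z + Q) (t - 4)
    push_cast at *
    obtain ⟨Q', hQ', hd⟩ := ih (Z + Q) (by omega) (by omega) (by omega) (by omega) (by omega)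
    refine ⟨Q + Q', ?_, by rwa [← add_assoc]⟩
    rw [Multiset.map_add, hQ, hQ', show q + 1 + q₁ = (q + q₁) + 1 by omega,
      Multiset.replicate_succ]
    rfl

/-! ### Configurations imposing independent conditions -/

set_option maxHeartbeats 1000000 in
/-- A suitable configuration of points of multiplicity at least three and of sufficiently many
double points imposes independent conditions in degree `t`, if the expected dimension is between one and
three. -/
theorem exists_dim_le [CharZero K] {t m e : ℕ} {s : ℤ} {A : Multiset ℕ}
    (ht : 2 ≤ t) (hm3 : 3 ≤ m) (hmA : m = 3 ∨ m ∈ A) (hA : ∀ d ∈ A, 3 ≤ d ∧ d ≤ m)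
    (hs : 1 ≤ s ∧ s ≤ 3) (hme : ((m : ℤ) - 1) * (t - 1) ≤ 2 * e)
    (hsz : 2 * size A + 6 * e + 2 * s = (t + 1) * (t + 2)) :
    ∃ Z : Multiset ((K × K) × ℕ), Z.map Prod.snd = A + Multiset.replicate e 2 ∧ dim Z t ≤ s := by
  have hdt : ∀ d ∈ A, d * (d + 1) ≤ 2 * size A ∧ d ≤ t := by
    intro d hd
    obtain ⟨A', rfl⟩ := Multiset.exists_cons_of_mem hd
    have h1 := size_nonneg A'
    have h2 := two_mul_triangle d
    rw [size_cons] at *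
    refine ⟨by omega, ?_⟩
    by_contra hlt
    have : (t : ℤ) + 1 ≤ d := by omega
    nlinarith
  have hmt : m ≤ t + 1 := by
    rcases hmA with rfl | h
    · omega
    · have := (hdt m h).2
      omega
  have het : (t : ℤ) - 1 ≤ e := by
    have : (2 : ℤ) ≤ m - 1 := by omega
    nlinarith
  have hN : ∀ j : ℤ, -2 ≤ j → 2 * dim (K := K) 0 j = (j + 1) * (j + 2) :=
    fun j hj => two_mul_dim_zero hj
  have hroom : ∀ d A', d ::ₘ A' ≤ A → size A' + 4 ≤ dim (K := K) 0 (t - d) := by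
    intro d A' hle
    have hd : d ∈ A := Multiset.mem_of_le hle (Multiset.mem_cons_self _ _)
    obtain ⟨hd3, hdm⟩ := hA d hd
    have h1 := (hdt d hd).2
    obtain ⟨B, rfl⟩ := Multiset.le_iff_exists_add.1 hle
    have h2 := two_mul_triangle d
    have h3 := size_nonneg B
    rw [size_add, size_cons] at hsz
    have h4 := hN (t - d) (by omega)
    have h5 : ((d : ℤ) - 1) * (t - 1) ≤ (m - 1) * (t - 1) :=
      mul_le_mul_of_nonneg_right (by omega) (by omega)
    have h6 : 0 ≤ ((d : ℤ) - 3) * (t + 2 * d + 1) := mul_nonneg (by omega) (by omega)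
    nlinarith
  obtain ⟨Z, hZ, h1, h2, h3⟩ := exists_points_three_le (K := K) t m A hA hroom
  have hexp := fun j : ℤ => dim_zero_le Z j
  simp only [hZ] at hexp
  have x2 := hexp (t - 2)
  have x3 := hexp (t - 3)
  have n1 := hN (t - 1) (by omega)
  have n2 := hN (t - 2) (by omega)
  have n12 : dim (K := K) 0 (t - 1) = dim (K := K) 0 (t - 2) + t := by linarith
  have n01 : dim (K := K) 0 (t - 1) = size A + 3 * e + s - (t + 1) := by linarith
  -- The lower bound for `e` leaves room for conditions lost in degree `t - 2` only if `m ≤ 4`.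
  have F2 : dim Z (t - 2) = dim (K := K) 0 (t - 2) - size A ∨
      (6 * (dim Z (t - 2) - (dim (K := K) 0 (t - 2) - size A)) ≤ t + 1 - s ∧
        (dim Z (t - 4) = 0 ∨ (dim Z (t - 5) = 0 ∧ 3 * (t - 1) ≤ 2 * e))) := by
    rcases h2 with h2 | ⟨h2, h2'⟩
    · exact Or.inl h2
    by_cases hx : dim Z (t - 2) = dim (K := K) 0 (t - 2) - size A
    · exact Or.inl hx
    right
    have nm := hN (t - m - 1) (by omega)
    have hm4 : m ≤ 4 := by
      by_contra hlt
      have h5 : (5 : ℤ) ≤ m := by omega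
      have h6 : 0 ≤ ((m : ℤ) - 5) * t := mul_nonneg (by omega) (by omega)
      have h7 : 0 ≤ ((m : ℤ) - 5) * (m + 1) := mul_nonneg (by omega) (by omega)
      nlinarith
    obtain rfl | rfl : m = 3 ∨ m = 4 := by omega
    · refine ⟨by push_cast at *; linarith, Or.inl ?_⟩
      rwa [show (t : ℤ) - (3 : ℕ) - 1 = t - 4 by omega] at h2
    · refine ⟨by push_cast at *; linarith, Or.inr ⟨?_, by push_cast at *; omega⟩⟩
      rwa [show (t : ℤ) - (4 : ℕ) - 1 = t - 5 by omega] at h2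
  -- If `dim Z (t - 4)` is positive, then few conditions are lost in degree `t - 3`.
  have F3 : 0 < dim Z (t - 4) →
      2 * (dim Z (t - 3) - (dim (K := K) 0 (t - 3) - size A)) ≤ t - 1 := by
    intro hpos
    have ht4 : 4 ≤ t := by
      by_contra hlt
      rw [dim_eq_zero Z (by omega)] at hpos
      omega
    rcases h3 hpos with h3 | ⟨hm, h3⟩ | ⟨hm, h3⟩
    · omega
    · have n5 := hN (t - 5) (by omega)
      nlinarith
    · have hmt' : m ≤ t := by
        rcases hmA with rfl | h
        · omega
        · exact (hdt m h).2
      have nm := hN (t - m - 2) (by omega)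
      have h6 : 0 ≤ ((m : ℤ) - 4) * t := mul_nonneg (by omega) (by omega)
      have h7 : 0 ≤ ((m : ℤ) - 4) * m := mul_nonneg (by omega) (by omega)
      nlinarith
  -- The last batch consists of `q₁ = ⌊(t + 1) / 2⌋` double points.
  obtain ⟨q₁, ε, hq₁, hε⟩ : ∃ (q₁ : ℕ) (ε : ℤ), (t : ℤ) + 1 = 2 * q₁ + ε ∧ 0 ≤ ε ∧ ε ≤ 1 := by
    refine ⟨(t + 1) / 2, ((t + 1) % 2 : ℕ), ?_, ?_, ?_⟩ <;> omega
  obtain ⟨hε0, hε1⟩ := hε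
  -- In the degrees `t ≤ 4` the divisibility of the expected dimension by three matters.
  have hM : 3 ≤ q₁ + (s - ε) := by
    by_contra hlt
    have hA0 := size_nonneg A
    have ht' : t = 2 ∨ t = 3 ∨ t = 4 := by omega
    by_cases hA' : A = 0
    · subst hA'
      rw [size_zero] at hsz
      rcases ht' with rfl | rfl | rfl <;> norm_num at hsz <;> omega
    · obtain ⟨d, hd⟩ := Multiset.exists_mem_of_ne_zero hA'
      have h4 := (hdt d hd).1
      have h5 : (3 : ℤ) ≤ d := by exact_mod_cast (hA d hd).1
      have h6 : 12 ≤ 2 * size A := by nlinarith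
      rcases ht' with rfl | rfl | rfl <;> norm_num at hsz <;> omega
  obtain ⟨q, hq⟩ : ∃ q : ℕ, e = q + q₁ := ⟨e - q₁, by omega⟩
  obtain ⟨Q, k, q', hQ, hk, b1, b2, b3, b4, b5, b6⟩ :=
    exists_descent (t := t) (M := q₁ + (s - ε)) (by omega) q Z (by omega)
  suffices h : ∃ Q' : Multiset ((K × K) × ℕ), Q'.map Prod.snd = Multiset.replicate (q' + q₁) 2 ∧
      dim (Z + Q + Q') t ≤ (s - ε) + ε by
    obtain ⟨Q', hQ', h⟩ := h
    refine ⟨Z + Q + Q', ?_, by omega⟩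
    rw [Multiset.map_add, Multiset.map_add, hZ, hQ, hQ', add_assoc, ← Multiset.replicate_add,
      show k + (q' + q₁) = e by omega]
  have hk0 : k = 0 → Q = 0 := by
    rintro rfl
    simpa using hQ
  have p2 := dim_nonneg (Z + Q) (t - 2)
  have p3 := dim_nonneg (Z + Q) (t - 3)
  have p4 := dim_nonneg (Z + Q) (t - 4)
  have m3 := dim_mono (Z + Q) (i := (t : ℤ) - 4) (j := t - 3) (by omega)
  have m2 := dim_mono (Z + Q) (i := (t : ℤ) - 3) (j := t - 2) (by omega)
  have g2 := dim_growth (Z := Z + Q) (j := t - 2) (t - 3) (t - 4) (by omega) (by omega)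
  have g1 := dim_growth (Z := Z + Q) (j := t - 1) (t - 2) (t - 3) (by omega) (by omega)
  have hk0' : k = 0 → dim (Z + Q) (t - 2) = dim Z (t - 2) := fun h => by rw [hk0 h, add_zero]
  have hk0'' : k = 0 → dim (Z + Q) (t - 1) = dim Z (t - 1) := fun h => by rw [hk0 h, add_zero]
  -- If the system of degree `t - 3` is zero, then the configuration is balanced already. If not,
  -- then the rank in degree `t - 1` is still the one of `Z`.
  by_cases hf3 : 0 < dim (Z + Q) (t - 3)
  · have hρ := b4 hf3
    by_cases hx : dim Z (t - 2) = dim (K := K) 0 (t - 2) - size A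
    · refine exists_balance hq₁ hε0 (by omega) (ρ := t) (by omega) q' (Z + Q) b1 (by omega)
        (by omega) ?_ (Or.inl (by omega))
      by_cases hf4 : 0 < dim (Z + Q) (t - 4)
      · have h5 := b5 hf4
        have h6 := F3 (hf4.trans_le (dim_anti (Multiset.le_add_right Z Q) _))
        have ht4 : 4 ≤ t := by
          by_contra hlt
          rw [dim_eq_zero (Z + Q) (by omega)] at hf4
          omega
        have n3 := hN (t - 3) (by omega)
        have n23 : dim (K := K) 0 (t - 2) = dim (K := K) 0 (t - 3) + (t - 1) := by linarith
        omega
      · omega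
    · have hx' := F2.resolve_left hx
      have hf4 : dim (Z + Q) (t - 4) = 0 := by
        rcases hx'.2 with h4 | ⟨h5, h6⟩
        · have := dim_anti (Multiset.le_add_right Z Q) (t - 4)
          omega
        · have h7 : rk Z (t - 4) ≤ max 0 ((t : ℤ) - 4 + 1) := rk_le Z _
          rw [rk, show (t : ℤ) - 4 - 1 = t - 5 by omega, h5] at h7
          omega
      refine exists_balance hq₁ hε0 (by omega)
        (ρ := t - (dim Z (t - 2) - (dim (K := K) 0 (t - 2) - size A))) (by omega) q' (Z + Q) b1
        (by omega) (by omega) (by omega) (Or.inr ⟨hf4, fun _ => by omega⟩)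
  · exact exists_two_batches hq₁ hε0 b1 b2 (by omega) (by omega)

theorem exists_add_of_map_eq_add {α β : Type*} (f : α → β) (S T : Multiset β) :
    ∀ Z : Multiset α, Z.map f = S + T →
      ∃ Z₁ Z₂ : Multiset α, Z = Z₁ + Z₂ ∧ Z₁.map f = S ∧ Z₂.map f = T := by
  classical
  induction T using Multiset.induction_on with
  | empty => exact fun Z hZ => ⟨Z, 0, by simp, by simpa using hZ, rfl⟩
  | cons b T ih =>
    intro Z hZ
    rw [Multiset.add_cons, ← Multiset.map_eq_cons] at hZ
    obtain ⟨a, ha, hab, hZ⟩ := hZ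
    obtain ⟨Z₁, Z₂, h, h₁, h₂⟩ := ih _ hZ
    refine ⟨Z₁, a ::ₘ Z₂, ?_, h₁, by rw [Multiset.map_cons, hab, h₂]⟩
    rw [Multiset.add_cons, ← h, Multiset.cons_erase ha]

/-- The multiplicities are split into those at least three, the twos and the ones. -/
theorem eq_filter_add_replicate (S : Multiset ℕ) (hS : ∀ d ∈ S, 1 ≤ d) :
    S = S.filter (3 ≤ ·) + Multiset.replicate (S.count 2) 2 +
      Multiset.replicate (S.count 1) 1 := by
  ext a
  rw [Multiset.count_add, Multiset.count_add, Multiset.count_filter, Multiset.count_replicate,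
    Multiset.count_replicate]
  by_cases h0 : a = 0
  · subst h0
    have : (0 : ℕ) ∉ S := fun h => by simpa using hS 0 h
    simp [Multiset.count_eq_zero_of_notMem this]
  by_cases h1 : a = 1
  · subst h1
    simp
  by_cases h2 : a = 2
  · subst h2
    simp
  rw [if_pos (by omega), if_neg (Ne.symm h2), if_neg (Ne.symm h1)]
  rfl

/-- Suitably chosen simple points impose independent conditions as long as the system has
sufficiently large dimension. -/
theorem exists_simple_points [CharZero K] {t : ℕ} (n : ℕ) :
    ∀ Z : Multiset ((K × K) × ℕ), n ≤ dim Z t →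
      ∃ Q : Multiset ((K × K) × ℕ), Q.map Prod.snd = Multiset.replicate n 1 ∧
        dim (Z + Q) t = dim Z t - n := by
  induction n with
  | zero => exact fun Z _ => ⟨0, rfl, by simp⟩
  | succ n ih =>
    intro Z hZ
    obtain ⟨Q, hQ, -, hlt⟩ := exists_point Z 1 t
    have h1 := hlt t le_rfl le_rfl (by omega)
    have h2 := dim_le_dim_add Z Q t
    rw [hQ, show size {1} = 1 from rfl] at h2
    obtain ⟨Q', hQ', h⟩ := ih (Z + Q) (by omega)
    refine ⟨Q + Q', ?_, ?_⟩
    · rw [Multiset.map_add, hQ, hQ', Multiset.replicate_succ]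
      rfl
    · rw [← add_assoc]
      omega

/-- There is a configuration of points with the given multiplicities that imposes independent
conditions on the polynomials of degree at most `t`. -/
theorem exists_dim_add_size_eq [CharZero K] {t m e : ℕ} {S : Multiset ℕ}
    (hS : ∀ d ∈ S, 1 ≤ d ∧ d ≤ m) (he : 1 ≤ e) (htwo : e ≤ S.count 2)
    (hlen : 2 * size S + 2 ≤ (t + 1) * (t + 2)) (hnodes : ((m : ℤ) - 1) * (t - 1) ≤ 2 * e) :
    ∃ Z : Multiset ((K × K) × ℕ), Z.map Prod.snd = S ∧
      dim Z t + size S = dim (K := K) 0 t := by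
  have hsplit := eq_filter_add_replicate S fun d hd => (hS d hd).1
  set A := S.filter (3 ≤ ·) with hA
  set e₂ := S.count 2
  set c := S.count 1
  have hsize : size S = size A + 3 * e₂ + c := by
    rw [hsplit, size_add, size_add, size_replicate, size_replicate]
    norm_num
    ring
  have hA0 := size_nonneg A
  have hN := two_mul_dim_zero (K := K) (j := t) (by omega)
  have ht : 2 ≤ t := by
    by_contra hlt
    have : t = 0 ∨ t = 1 := by omega
    rcases this with rfl | rfl <;> norm_num at hlen <;> omega
  obtain ⟨m', hm3, hmA, hAm, hm'⟩ : ∃ m' : ℕ, 3 ≤ m' ∧ (m' = 3 ∨ m' ∈ A) ∧ (∀ d ∈ A, d ≤ m') ∧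
      (A = 0 ∧ m' = 3 ∨ m' ≤ m) := by
    by_cases hA' : A = 0
    · exact ⟨3, le_rfl, Or.inl rfl, by simp [hA'], Or.inl ⟨hA', rfl⟩⟩
    · obtain ⟨d, hd, hmax⟩ := Finset.exists_max_image A.toFinset id
        (Multiset.toFinset_nonempty.2 hA')
      simp only [Multiset.mem_toFinset, id] at hd hmax
      have hd' := Multiset.mem_filter.1 hd
      exact ⟨d, hd'.2, Or.inr hd, hmax, Or.inr (hS d hd'.1).2⟩
  -- further double points make the expected dimension as small as possible
  obtain ⟨i, s, hs1, hs3, hi⟩ : ∃ (i : ℕ) (s : ℤ), 1 ≤ s ∧ s ≤ 3 ∧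
      dim (K := K) 0 t - size A - 3 * e₂ = 3 * i + s := by
    refine ⟨((dim (K := K) 0 t - size A - 3 * e₂ - 1) / 3).toNat,
      (dim (K := K) 0 t - size A - 3 * e₂ - 1) % 3 + 1, ?_, ?_, ?_⟩ <;> omega
  have hme : ((m' : ℤ) - 1) * (t - 1) ≤ 2 * (e₂ + i : ℕ) := by
    rcases hm' with ⟨hA', rfl⟩ | hm'
    · rw [hA', size_zero] at hi
      have : 0 ≤ ((t : ℤ) - 1) * (t - 2) := mul_nonneg (by omega) (by omega)
      push_cast
      nlinarith
    · have : ((m' : ℤ) - 1) * (t - 1) ≤ ((m : ℤ) - 1) * (t - 1) :=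
        mul_le_mul_of_nonneg_right (by omega) (by omega)
      push_cast
      omega
  obtain ⟨Z, hZ, hd⟩ := exists_dim_le (K := K) ht hm3 hmA
    (fun d hd => ⟨(Multiset.mem_filter.1 hd).2, hAm d hd⟩) ⟨hs1, hs3⟩ hme
    (by push_cast; linarith)
  rw [Multiset.replicate_add, ← add_assoc] at hZ
  obtain ⟨Z₁, Z₂, rfl, h₁, h₂⟩ := exists_add_of_map_eq_add _ _ _ Z hZ
  have a1 := dim_le_dim_add Z₁ Z₂ t
  have a2 := dim_zero_le Z₁ t
  rw [h₂, size_replicate] at a1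
  rw [h₁, size_add, size_replicate] at a2
  norm_num at a1 a2
  obtain ⟨Q, hQ, h⟩ := exists_simple_points c Z₁ (t := t) (by omega)
  refine ⟨Z₁ + Q, ?_, by omega⟩
  rw [Multiset.map_add, h₁, hQ, ← hsplit]

/-! ### Powers of the ideal of a point -/

/-- The expansion `F(v₀, v₁ + y₁, v₂ + y₂)` of a polynomial in the homogeneous coordinates. -/
def expand (v : Fin 3 → K) : CoordRing K →ₐ[K] MvPolynomial (Fin 2) K :=
  aeval ![C (v 0), C (v 1) + X 0, C (v 2) + X 1]

theorem constantCoeff_expand (v : Fin 3 → K) (F : CoordRing K) :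
    constantCoeff (expand v F) = eval v F := by
  have h : (constantCoeff : MvPolynomial (Fin 2) K →+* K).comp (expand v).toRingHom = eval v := by
    refine ringHom_ext (fun a => by simp) fun i => ?_
    fin_cases i <;> simp [expand]
  exact DFunLike.congr_fun h F

theorem expand_mem_of_mem_pointIdeal_pow {Q : P2 K} {d : ℕ} {F : CoordRing K}
    (hF : F ∈ pointIdeal Q ^ d) : expand Q.rep F ∈ idealOfVars (Fin 2) K ^ d := by
  have h1 : (pointIdeal Q).map (expand Q.rep) ≤ idealOfVars (Fin 2) K := by
    rw [pointIdeal, Ideal.map_span, Ideal.span_le]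
    rintro _ ⟨f, ⟨-, hf⟩, rfl⟩
    rw [SetLike.mem_coe, ← pow_one (idealOfVars (Fin 2) K), mem_pow_idealOfVars_iff']
    intro m hm
    obtain rfl : m = 0 := by
      rw [← Finsupp.degree_eq_zero_iff]
      omega
    exact (constantCoeff_expand Q.rep f).trans hf
  have h2 := Ideal.mem_map_of_mem (expand Q.rep) hF
  rw [Ideal.map_pow] at h2
  exact Ideal.pow_right_mono h1 d h2

/-- The exponents of the last two variables. -/
def tailExp (m : Fin 3 →₀ ℕ) : Fin 2 →₀ ℕ :=
  Finsupp.single 0 (m 1) + Finsupp.single 1 (m 2)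

/-- The explicit form of the substitution of a constant for the first variable. -/
theorem aeval_C_X_X (c : K) (G : CoordRing K) :
    aeval (![C c, X 0, X 1] : Fin 3 → MvPolynomial (Fin 2) K) G =
      ∑ m ∈ G.support, monomial (tailExp m) (coeff m G * c ^ m 0) := by
  rw [aeval_def, eval₂_eq']
  refine Finset.sum_congr rfl fun m _ => ?_
  rw [Fin.prod_univ_three]
  simp only [Matrix.cons_val_zero, Matrix.cons_val_one, Matrix.cons_val, algebraMap_eq, tailExp,
    X_pow_eq_monomial, ← C_pow]
  rw [mul_assoc (C (c ^ m 0)), monomial_mul, one_mul, ← mul_assoc, ← C_mul, C_mul_monomial,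
    mul_one]

theorem eq_of_tailExp_eq {m m' : Fin 3 →₀ ℕ} (h : m.degree = m'.degree)
    (h' : tailExp m = tailExp m') : m = m' := by
  have h1 := DFunLike.congr_fun h' 0
  have h2 := DFunLike.congr_fun h' 1
  simp [tailExp] at h1 h2
  rw [Finsupp.degree_eq_sum, Finsupp.degree_eq_sum, Fin.sum_univ_three, Fin.sum_univ_three] at h
  ext i
  fin_cases i
  · simp only [Fin.zero_eta]
    omega
  · exact h1
  · exact h2

theorem coeff_aeval_C_X_X (c : K) {G : CoordRing K} {n : ℕ} (hG : G.IsHomogeneous n)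
    {m : Fin 3 →₀ ℕ} (hm : m ∈ G.support) :
    coeff (tailExp m) (aeval (![C c, X 0, X 1] : Fin 3 → MvPolynomial (Fin 2) K) G) =
      coeff m G * c ^ m 0 := by
  rw [aeval_C_X_X, coeff_sum, Finset.sum_eq_single m]
  · rw [coeff_monomial, if_pos rfl]
  · intro m' hm' hne
    rw [coeff_monomial, if_neg]
    intro h
    refine hne (eq_of_tailExp_eq ?_ h)
    rw [Finsupp.degree_apply, Finsupp.degree_apply, ← hG.degree_eq_sum_deg_support hm,
      ← hG.degree_eq_sum_deg_support hm']
  · exact fun h => absurd hm h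

/-- For forms, membership in a power of the ideal of a point is a condition on the order of
vanishing at the point. -/
theorem mem_pointIdeal_pow_iff {Q : P2 K} (hQ : Q.rep 0 ≠ 0) {n d : ℕ} {F : CoordRing K}
    (hF : F.IsHomogeneous n) :
    F ∈ pointIdeal Q ^ d ↔ expand Q.rep F ∈ idealOfVars (Fin 2) K ^ d := by
  refine ⟨expand_mem_of_mem_pointIdeal_pow, fun h => ?_⟩
  set v := Q.rep
  -- a linear change of coordinates moves the point to `[1 : 0 : 0]`
  let ψ : CoordRing K →ₐ[K] CoordRing K :=
    aeval ![X 0, X 1 + C (v 1 / v 0) * X 0, X 2 + C (v 2 / v 0) * X 0]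
  let ψ' : CoordRing K →ₐ[K] CoordRing K :=
    aeval ![X 0, X 1 - C (v 1 / v 0) * X 0, X 2 - C (v 2 / v 0) * X 0]
  have hψ : ψ'.comp ψ = AlgHom.id K _ := by
    refine algHom_ext fun i => ?_
    fin_cases i <;> simp [ψ, ψ', algHom_C]
  have hψF : F = ψ' (ψ F) := (DFunLike.congr_fun hψ F).symm
  have hG : (ψ F).IsHomogeneous n := by
    rw [← one_mul n]
    refine hF.aeval _ fun i => ?_
    fin_cases i
    · exact isHomogeneous_X _ _
    · exact (isHomogeneous_X _ _).add (isHomogeneous_C_mul_X _ _)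
    · exact (isHomogeneous_X _ _).add (isHomogeneous_C_mul_X _ _)
  have hexp : expand v =
      (aeval (![C (v 0), X 0, X 1] : Fin 3 → MvPolynomial (Fin 2) K)).comp ψ := by
    refine algHom_ext fun i => ?_
    fin_cases i
    · simp [expand, ψ]
    · simp [expand, ψ, algHom_C, ← C_mul, div_mul_cancel₀ _ hQ, algebraMap_eq, add_comm]
    · simp [expand, ψ, algHom_C, ← C_mul, div_mul_cancel₀ _ hQ, algebraMap_eq, add_comm]
  rw [hexp, AlgHom.comp_apply, mem_pow_idealOfVars_iff'] at h
  have hy : ∀ i : Fin 3, X i - C (v i / v 0) * X 0 ∈ pointIdeal Q := fun i =>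
    Ideal.subset_span ⟨⟨1, (isHomogeneous_X _ _).sub (isHomogeneous_C_mul_X _ _)⟩, by
      simp [v, div_mul_cancel₀ _ hQ]⟩
  rw [hψF, (ψ F).as_sum, map_sum]
  refine Ideal.sum_mem _ fun m hm => ?_
  have hd : d ≤ m 1 + m 2 := by
    by_contra hlt
    have h1 := h (tailExp m) (by
      simp only [tailExp, map_add, Finsupp.degree_single]
      omega)
    rw [coeff_aeval_C_X_X _ hG hm] at h1
    rcases mul_eq_zero.1 h1 with h1 | h1
    · exact mem_support_iff.1 hm h1
    · exact pow_ne_zero _ hQ h1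
  rw [aeval_monomial, Finsupp.prod_fintype _ _ (fun i => pow_zero _), Fin.prod_univ_three]
  refine Ideal.mul_mem_left _ _ ?_
  rw [mul_assoc]
  refine Ideal.mul_mem_left _ _ (Ideal.pow_le_pow_right hd ?_)
  rw [pow_add]
  exact Ideal.mul_mem_mul (Ideal.pow_mem_pow (hy 1) _) (Ideal.pow_mem_pow (hy 2) _)

/-- The index set of all conditions imposed by points of multiplicities `mult`. -/
abbrev Conds {ι : Type*} (mult : ι → ℕ) : Type _ := Σ j, Cond (mult j)

/-- The conditions imposed on forms by the points with coordinate vectors `v j`, taken with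
multiplicities `mult j`. -/
def evalMap {ι : Type*} (mult : ι → ℕ) (v : ι → Fin 3 → K) :
    CoordRing K →ₗ[K] (Conds mult → K) :=
  LinearMap.pi fun x => (lcoeff K x.2.exponent).comp (expand (v x.1)).toLinearMap

theorem evalMap_apply {ι : Type*} (mult : ι → ℕ) (v : ι → Fin 3 → K) (F : CoordRing K)
    (x : Conds mult) : evalMap mult v F x = coeff x.2.exponent (expand (v x.1) F) := rfl

theorem evalMap_eq_zero_iff {ι : Type*} {mult : ι → ℕ} {v : ι → Fin 3 → K} {F : CoordRing K} :
    evalMap mult v F = 0 ↔ ∀ j, expand (v j) F ∈ idealOfVars (Fin 2) K ^ mult j := by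
  simp only [← forall_cond_iff, funext_iff, evalMap_apply, Pi.zero_apply, Sigma.forall]

theorem card_conds {ι : Type*} [Fintype ι] (mult : ι → ℕ) :
    Fintype.card (Conds mult) = ∑ j, mult j * (mult j + 1) / 2 := by
  rw [Fintype.card_sigma]
  exact Finset.sum_congr rfl fun j _ => card_cond _

instance (t : ℕ) : FiniteDimensional K (homogeneousSubmodule (Fin 3) K t) := by
  refine Submodule.finiteDimensional_of_le (S₂ := restrictTotalDegree (Fin 3) K t) ?_
  intro f hf
  rw [mem_restrictTotalDegree]
  exact IsHomogeneous.totalDegree_le hf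

/-- The points `P j` with multiplicities `mult j` impose independent conditions on the forms of
degree `t` as soon as the conditions can be met with arbitrary values. -/
theorem imposesIndependentConditions {ι : Type*} [Fintype ι] {P : ι → P2 K} {mult : ι → ℕ}
    {t : ℕ}
    (hP : ∀ j, (P j).rep 0 ≠ 0)
    (hsurj : ∀ c, ∃ F : CoordRing K,
      F.IsHomogeneous t ∧ evalMap mult (fun j => (P j).rep) F = c) :
    ImposesIndependentConditions P mult t := by
  have h := finrank_map_add_finrank_inf_ker (evalMap mult fun j => (P j).rep)
    (homogeneousSubmodule (Fin 3) K t)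
  have h1 : (homogeneousSubmodule (Fin 3) K t).map (evalMap mult fun j => (P j).rep) = ⊤ := by
    rw [eq_top_iff]
    rintro c -
    obtain ⟨F, hF, rfl⟩ := hsurj c
    exact ⟨F, hF, rfl⟩
  have h2 : homogeneousSubmodule (Fin 3) K t ⊓ LinearMap.ker (evalMap mult fun j => (P j).rep) =
      formsThrough P mult t := by
    ext F
    simp only [formsThrough, Submodule.mem_inf, LinearMap.mem_ker, evalMap_eq_zero_iff,
      Submodule.restrictScalars_mem, Submodule.mem_iInf]
    refine and_congr_right fun hF => forall_congr' fun j => ?_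
    exact (mem_pointIdeal_pow_iff (hP j) hF).symm
  rw [h1, h2, finrank_top, Module.finrank_fintype_fun_eq_card, card_conds] at h
  rw [ImposesIndependentConditions, add_comm]
  exact h

/-! ### Conditions at generic points and multihomogeneity -/

/-- A restatement of `Finsupp.degree_eq_weight_one` for the weights that define homogeneity. -/
theorem weight_one_apply {σ : Type*} (m : σ →₀ ℕ) :
    Finsupp.weight (1 : σ → ℕ) m = m.degree :=
  (DFunLike.congr_fun Finsupp.degree_eq_weight_one m).symm

section Generic

/-- A polynomial with polynomial coefficients is homogeneous of degree `n` in both sets of variables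
together. -/
def IsBihomogeneous {σ τ : Type*} (G : MvPolynomial σ (MvPolynomial τ K)) (n : ℕ) : Prop :=
  ∀ k m, coeff m (coeff k G) ≠ 0 → m.degree + k.degree = n

theorem IsBihomogeneous.mul {σ τ : Type*} {G H : MvPolynomial σ (MvPolynomial τ K)} {n n' : ℕ}
    (hG : IsBihomogeneous G n) (hH : IsBihomogeneous H n') : IsBihomogeneous (G * H) (n + n') := by
  classical
  intro k m h
  rw [coeff_mul, coeff_sum] at h
  obtain ⟨⟨k₁, k₂⟩, hk, h⟩ := Finset.exists_ne_zero_of_sum_ne_zero h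
  rw [coeff_mul] at h
  obtain ⟨⟨m₁, m₂⟩, hm, h⟩ := Finset.exists_ne_zero_of_sum_ne_zero h
  rw [Finset.HasAntidiagonal.mem_antidiagonal] at hk hm
  simp only at hk hm h
  have h1 := hG k₁ m₁ (left_ne_zero_of_mul h)
  have h2 := hH k₂ m₂ (right_ne_zero_of_mul h)
  rw [← hk, ← hm, map_add, map_add]
  omega

theorem IsBihomogeneous.add {σ τ : Type*} {G H : MvPolynomial σ (MvPolynomial τ K)} {n : ℕ}
    (hG : IsBihomogeneous G n) (hH : IsBihomogeneous H n) : IsBihomogeneous (G + H) n := by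
  intro k m h
  by_cases h1 : coeff m (coeff k G) = 0
  · refine hH k m fun h2 => h ?_
    rw [coeff_add, coeff_add, h1, h2, add_zero]
  · exact hG k m h1

theorem isBihomogeneous_C {σ τ : Type*} {a : MvPolynomial τ K} {n : ℕ} (ha : a.IsHomogeneous n) :
    IsBihomogeneous (C a : MvPolynomial σ (MvPolynomial τ K)) n := by
  classical
  intro k m h
  rw [coeff_C] at h
  split_ifs at h with hk
  · by_contra hne
    exact h (ha.coeff_eq_zero (by rwa [← hk, map_zero, add_zero] at hne))
  · simp at h

theorem isBihomogeneous_X {σ τ : Type*} (i : σ) :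
    IsBihomogeneous (X i : MvPolynomial σ (MvPolynomial τ K)) 1 := by
  classical
  intro k m h
  rw [coeff_X] at h
  split_ifs at h with hk
  · rw [coeff_one] at h
    split_ifs at h with hm
    · simp [← hk, ← hm, Finsupp.degree_single]
    · simp at h
  · simp at h

theorem IsBihomogeneous.pow {σ τ : Type*} {G : MvPolynomial σ (MvPolynomial τ K)} {n : ℕ}
    (hG : IsBihomogeneous G n) (a : ℕ) : IsBihomogeneous (G ^ a) (a * n) := by
  induction a with
  | zero => simpa using isBihomogeneous_C (isHomogeneous_one τ K)
  | succ a ih =>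
    rw [pow_succ, add_mul, one_mul]
    exact ih.mul hG

theorem IsBihomogeneous.isHomogeneous_coeff {σ τ : Type*} {G : MvPolynomial σ (MvPolynomial τ K)}
    {n : ℕ} (hG : IsBihomogeneous G n) (k : σ →₀ ℕ) :
    (coeff k G).IsHomogeneous (n - k.degree) := by
  rw [IsHomogeneous, IsWeightedHomogeneous]
  intro m hm
  have := hG k m hm
  rw [weight_one_apply]
  omega

/-- The expansion `F(x₀, x₁ + y₁, x₂ + y₂)` of a polynomial at the generic point. -/
def genericExpand : CoordRing K →ₐ[K] MvPolynomial (Fin 2) (CoordRing K) :=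
  aeval ![C (X 0), C (X 1) + X 0, C (X 2) + X 1]

theorem map_genericExpand (v : Fin 3 → K) (F : CoordRing K) :
    map (eval v) (genericExpand F) = expand v F := by
  have h : (map (eval v)).comp (genericExpand (K := K)).toRingHom = (expand v).toRingHom := by
    refine ringHom_ext (fun a => ?_) fun i => ?_
    · simp [genericExpand, expand, MvPolynomial.algebraMap_apply]
    · fin_cases i <;> simp [genericExpand, expand]
  exact DFunLike.congr_fun h F

theorem isBihomogeneous_genericExpand {F : CoordRing K} {n : ℕ} (hF : F.IsHomogeneous n) :
    IsBihomogeneous (genericExpand F) n := by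
  induction hF using IsWeightedHomogeneous.induction_on with
  | zero => intro k m h; simp at h
  | add p q _ _ hp hq => rw [map_add]; exact hp.add hq
  | monomial d r hr =>
    have hd : 0 + d 0 * 1 + d 1 * 1 + d 2 * 1 = n := by
      rw [weight_one_apply, Finsupp.degree_eq_sum,
        Fin.sum_univ_three] at hr
      omega
    rw [genericExpand, aeval_monomial, Finsupp.prod_fintype _ _ (fun i => pow_zero _),
      Fin.prod_univ_three, ← mul_assoc, ← mul_assoc, ← hd]
    refine IsBihomogeneous.mul (IsBihomogeneous.mul (IsBihomogeneous.mul
      (isBihomogeneous_C (isHomogeneous_C _ r))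
      (IsBihomogeneous.pow ?_ _)) (IsBihomogeneous.pow ?_ _)) (IsBihomogeneous.pow ?_ _)
    · exact isBihomogeneous_C (isHomogeneous_X _ _)
    · exact (isBihomogeneous_C (isHomogeneous_X _ _)).add (isBihomogeneous_X _)
    · exact (isBihomogeneous_C (isHomogeneous_X _ _)).add (isBihomogeneous_X _)

end Generic

section Multihomogeneous

variable {ι : Type*} [DecidableEq ι]

/-- The weights that define multihomogeneous polynomials on a product of planes. -/
abbrev multiWeight (ι : Type*) [DecidableEq ι] : ι × Fin 3 → ι → ℕ :=
  fun p => Pi.single p.1 1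

theorem isWeightedHomogeneous_rename {F : CoordRing K} {n : ℕ} (hF : F.IsHomogeneous n) (j : ι) :
    IsWeightedHomogeneous (multiWeight ι) (rename (fun i => (j, i)) F) (Pi.single j n) := by
  intro m hm
  obtain ⟨u, rfl, hu⟩ := coeff_rename_ne_zero _ _ _ hm
  have h1 := hF hu
  rw [weight_one_apply, Finsupp.degree_eq_sum] at h1
  rw [Finsupp.weight_apply, Finsupp.sum_mapDomain_index (by simp) (fun _ _ _ => add_smul _ _ _),
    Finsupp.sum_fintype _ _ (by simp), ← h1]
  ext k
  rw [Finset.sum_apply]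
  by_cases hk : k = j
  · subst hk; simp
  · simp [Pi.single_eq_of_ne hk]

/-- A multihomogeneous polynomial that does not vanish at some coordinate vectors does not vanish
at proportional ones. -/
theorem eval_smul_ne_zero {g : MvPolynomial (ι × Fin 3) K} {D : ι → ℕ} [Fintype ι]
    (hg : IsWeightedHomogeneous (multiWeight ι) g D) {v w : ι → Fin 3 → K} (a : ι → K)
    (hw : ∀ j, v j = a j • w j)
    (h : eval (fun p : ι × Fin 3 => v p.1 p.2) g ≠ 0) :
    eval (fun p : ι × Fin 3 => w p.1 p.2) g ≠ 0 := by
  have key : eval (fun p : ι × Fin 3 => v p.1 p.2) g =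
      (∏ j, a j ^ D j) * eval (fun p : ι × Fin 3 => w p.1 p.2) g := by
    rw [eval_eq', eval_eq', Finset.mul_sum]
    refine Finset.sum_congr rfl fun m hm => ?_
    have h1 := hg (mem_support_iff.1 hm)
    have h2 : ∏ j, a j ^ D j = ∏ p : ι × Fin 3, a p.1 ^ m p := by
      rw [Fintype.prod_prod_type]
      refine Finset.prod_congr rfl fun j _ => ?_
      change _ = ∏ y, a j ^ m (j, y)
      rw [Finset.prod_pow_eq_pow_sum, ← h1, Finsupp.weight_apply,
        Finsupp.sum_fintype _ _ (by simp), Finset.sum_apply, Fintype.sum_prod_type]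
      congr 1
      rw [Finset.sum_eq_single j]
      · simp [multiWeight]
      · intro k _ hk
        simp [multiWeight, Pi.single_eq_of_ne (Ne.symm hk)]
      · simp
    rw [h2, mul_left_comm, ← Finset.prod_mul_distrib]
    refine congrArg _ (Finset.prod_congr rfl fun p _ => ?_)
    rw [hw, Pi.smul_apply, smul_eq_mul, mul_pow]
  intro h0
  exact h (by rw [key, h0, mul_zero])

/-- A determinant is multihomogeneous if the multidegrees of the entries depend on the row only. -/
theorem isWeightedHomogeneous_det {κ : Type*} [Fintype κ] [DecidableEq κ]
    {M : Matrix κ κ (MvPolynomial (ι × Fin 3) K)} {D : κ → ι → ℕ}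
    (h : ∀ x y, IsWeightedHomogeneous (multiWeight ι) (M x y) (D x)) :
    IsWeightedHomogeneous (multiWeight ι) M.det (∑ x, D x) := by
  rw [← Matrix.det_transpose, Matrix.det_apply]
  refine IsWeightedHomogeneous.sum _ _ _ fun σ _ => ?_
  have h1 : IsWeightedHomogeneous (multiWeight ι) (∏ i, M.transpose (σ i) i) (∑ x, D x) :=
    IsWeightedHomogeneous.prod _ _ _ fun i _ => h i (σ i)
  rw [Units.smul_def, zsmul_eq_mul]
  rcases Int.units_eq_one_or (Equiv.Perm.sign σ) with hs | hs
  · simpa [hs] using h1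
  · simpa [hs] using h1.neg

end Multihomogeneous

/-! ### From the affine chart to forms -/

theorem exists_eq_map_of_map_eq {ι α β : Type*} [Nonempty α] (f : α → β) (g : ι → β)
    (s : Finset ι) : ∀ Z : Multiset α, Z.map f = s.val.map g →
      ∃ p : ι → α, Z = s.val.map p ∧ ∀ j ∈ s, f (p j) = g j := by
  classical
  induction s using Finset.induction_on with
  | empty =>
    intro Z hZ
    exact ⟨fun _ => Classical.arbitrary α, by simpa using hZ, by simp⟩
  | insert a s ha ih =>
    intro Z hZ
    rw [Finset.insert_val_of_notMem ha, Multiset.map_cons, ← Multiset.map_eq_cons] at hZ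
    obtain ⟨b, hb, hab, hZ⟩ := hZ
    obtain ⟨p, hp, hp'⟩ := ih _ hZ
    refine ⟨Function.update p a b, ?_, fun j hj => ?_⟩
    · rw [Finset.insert_val_of_notMem ha, Multiset.map_cons, Function.update_self,
        ← Multiset.cons_erase hb, hp]
      congr 1
      refine Multiset.map_congr rfl fun j hj => ?_
      rw [Function.update_of_ne]
      rintro rfl
      exact ha hj
    · rcases Finset.mem_insert.1 hj with rfl | hj'
      · rwa [Function.update_self]
      · rw [Function.update_of_ne fun h : j = a => ha (h ▸ hj'), hp' j hj']

/-- Dehomogenization with respect to the first variable. -/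
def dehom : CoordRing K →ₐ[K] MvPolynomial (Fin 2) K := aeval ![C 1, X 0, X 1]

theorem expand_eq_translate_comp_dehom (p : K × K) :
    expand ![1, p.1, p.2] = (translate p).comp dehom := by
  refine algHom_ext fun i => ?_
  fin_cases i <;> simp [expand, translate, dehom, add_comm]

/-- Dehomogenization is injective on forms of a given degree. -/
theorem eq_zero_of_dehom_eq_zero {F : CoordRing K} {t : ℕ} (hF : F.IsHomogeneous t)
    (h : dehom F = 0) :
    F = 0 := by
  by_contra h0
  obtain ⟨m, hm⟩ := Finset.nonempty_of_ne_empty (mt support_eq_empty.1 h0)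
  have h1 := coeff_aeval_C_X_X 1 hF hm
  rw [one_pow, mul_one] at h1
  rw [dehom] at h
  rw [h, coeff_zero] at h1
  exact mem_support_iff.1 hm h1.symm

theorem totalDegree_dehom_le {F : CoordRing K} {t : ℕ} (hF : F.IsHomogeneous t) :
    (dehom F).totalDegree ≤ t := by
  rw [dehom, aeval_C_X_X]
  refine totalDegree_finsetSum_le fun m hm => (totalDegree_monomial_le _ _).trans ?_
  have h := hF.degree_eq_sum_deg_support hm
  rw [← Finsupp.degree_apply, Finsupp.degree_eq_sum, Fin.sum_univ_three] at h
  change (tailExp m).degree ≤ t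
  rw [tailExp, map_add, Finsupp.degree_single, Finsupp.degree_single]
  omega

theorem linSys_zero_le_map_dehom (t : ℕ) :
    linSys (0 : Multiset ((K × K) × ℕ)) t ≤
      (homogeneousSubmodule (Fin 3) K t).map dehom.toLinearMap := by
  rintro h ⟨hh, -⟩
  rw [h.as_sum]
  refine Submodule.sum_mem _ fun m hm => ?_
  have h1 := le_totalDegree hm
  have h2 := hh (by rintro rfl; simp at hm)
  have h3 : m 0 + m 1 ≤ t := by
    have h4 : m.degree ≤ t := by
      refine le_trans h1 ?_
      exact_mod_cast h2
    rwa [Finsupp.degree_eq_sum, Fin.sum_univ_two] at h4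
  refine ⟨monomial (Finsupp.single 0 (t - (m 0 + m 1)) + Finsupp.single 1 (m 0) +
    Finsupp.single 2 (m 1)) (coeff m h), ?_, ?_⟩
  · refine isHomogeneous_monomial _ ?_
    simp only [map_add, Finsupp.degree_single]
    omega
  · rw [AlgHom.toLinearMap_apply, dehom, aeval_monomial,
      Finsupp.prod_fintype _ _ (fun i => pow_zero _), Fin.prod_univ_three, monomial_eq,
      Finsupp.prod_fintype _ _ (fun i => pow_zero _), Fin.prod_univ_two]
    simp [algebraMap_eq]

theorem dim_zero_le_finrank_forms (t : ℕ) :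
    dim (K := K) 0 t ≤ Module.finrank K (homogeneousSubmodule (Fin 3) K t) := by
  have h1 := Submodule.finrank_mono (linSys_zero_le_map_dehom (K := K) t)
  have h2 := Submodule.finrank_map_le (dehom (K := K)).toLinearMap
    (homogeneousSubmodule (Fin 3) K t)
  rw [dim]
  exact_mod_cast h1.trans h2

/-- If points with multiplicities `mult` impose independent conditions on the polynomials of degree
at most `t`, then these conditions can be met with arbitrary values. -/
theorem exists_forall_exists_evalMap_eq {ι : Type*} [Fintype ι] (mult : ι → ℕ) {t : ℕ}
    {Z : Multiset ((K × K) × ℕ)} (hZ : Z.map Prod.snd = Finset.univ.val.map mult)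
    (hdim : dim Z t + size (Finset.univ.val.map mult) = dim (K := K) 0 t) :
    ∃ v : ι → Fin 3 → K,
      ∀ c, ∃ F : CoordRing K, F.IsHomogeneous t ∧ evalMap mult v F = c := by
  obtain ⟨p, rfl, hp⟩ := exists_eq_map_of_map_eq _ _ _ Z hZ
  let v : ι → Fin 3 → K := fun j => ![1, (p j).1.1, (p j).1.2]
  refine ⟨v, ?_⟩
  have h := finrank_map_add_finrank_inf_ker (evalMap mult v) (homogeneousSubmodule (Fin 3) K t)
  set N := homogeneousSubmodule (Fin 3) K t ⊓ LinearMap.ker (evalMap mult v) with hN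
  have hNfin : FiniteDimensional K N := Submodule.finiteDimensional_of_le inf_le_left
  have h1 : N.map dehom.toLinearMap ≤ linSys (Finset.univ.val.map p) t := by
    rintro _ ⟨F, ⟨hF, hF'⟩, rfl⟩
    refine ⟨fun _ => ?_, fun z hz => ?_⟩
    · exact_mod_cast totalDegree_dehom_le hF
    · obtain ⟨j, -, rfl⟩ := Multiset.mem_map.1 hz
      rw [pow_dvd_taylorAt_iff, forall_cond_iff]
      have h2 := evalMap_eq_zero_iff.1 (LinearMap.mem_ker.1 hF') j
      rw [expand_eq_translate_comp_dehom] at h2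
      rw [hp j (Finset.mem_univ j)]
      exact h2
  have h2 : N ⊓ LinearMap.ker (dehom (K := K)).toLinearMap = ⊥ := by
    rw [eq_bot_iff]
    rintro F ⟨⟨hF, -⟩, hF'⟩
    exact eq_zero_of_dehom_eq_zero hF hF'
  have h3 : Module.finrank K (N.map dehom.toLinearMap) = Module.finrank K N := by
    have h3 := finrank_map_add_finrank_inf_ker (dehom (K := K)).toLinearMap N
    rwa [h2, finrank_bot, add_zero] at h3
  have h4 := Submodule.finrank_mono h1
  have h5 := dim_zero_le_finrank_forms (K := K) t
  have h6 : size (Finset.univ.val.map mult) = Fintype.card (Conds mult) := by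
    rw [card_conds, size, Multiset.map_map]
    push_cast
    rfl
  have h7 : (homogeneousSubmodule (Fin 3) K t).map (evalMap mult v) = ⊤ := by
    refine Submodule.eq_top_of_finrank_eq (le_antisymm (Submodule.finrank_le _) ?_)
    rw [Module.finrank_fintype_fun_eq_card]
    rw [dim] at hdim
    have h8 : (Module.finrank K (homogeneousSubmodule (Fin 3) K t) : ℤ) =
      Module.finrank K ((homogeneousSubmodule (Fin 3) K t).map (evalMap mult v)) +
        Module.finrank K N := by exact_mod_cast h.symm
    omega
  intro c
  have h8 : c ∈ (homogeneousSubmodule (Fin 3) K t).map (evalMap mult v) := h7 ▸ Submodule.mem_top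
  obtain ⟨F, hF, rfl⟩ := h8
  exact ⟨F, hF, rfl⟩

/-! ### General points -/

/-- The matrix of the conditions imposed on forms `F y` by the generic points with multiplicities
`mult`. -/
def genericMatrix {ι : Type*} (mult : ι → ℕ) (F : Conds mult → CoordRing K) :
    Matrix (Conds mult) (Conds mult) (MvPolynomial (ι × Fin 3) K) :=
  fun x y => rename (fun i => (x.1, i)) (coeff x.2.exponent (genericExpand (F y)))

theorem eval_genericMatrix {ι : Type*} (mult : ι → ℕ) (F : Conds mult → CoordRing K)
    (v : ι → Fin 3 → K) (x y : Conds mult) : eval (fun p : ι × Fin 3 => v p.1 p.2) (genericMatrix mult F x y) =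
      evalMap mult v (F y) x := by
  rw [genericMatrix, eval_rename, evalMap_apply, ← map_genericExpand, coeff_map]
  rfl

section GenericPoints

variable {ι : Type*} [Fintype ι] [DecidableEq ι]

theorem eval_det_genericMatrix (mult : ι → ℕ) (F : Conds mult → CoordRing K) (v : ι → Fin 3 → K) :
    eval (fun p : ι × Fin 3 => v p.1 p.2) (genericMatrix mult F).det =
      (Matrix.of fun x y => evalMap mult v (F y) x).det := by
  rw [RingHom.map_det]
  congr 1
  ext x y
  rw [RingHom.mapMatrix_apply, Matrix.map_apply, eval_genericMatrix, Matrix.of_apply]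

theorem exists_evalMap_eq_of_eval_det_ne_zero {mult : ι → ℕ} {F : Conds mult → CoordRing K}
    {t : ℕ} (hF : ∀ y, (F y).IsHomogeneous t) {v : ι → Fin 3 → K}
    (h : eval (fun p : ι × Fin 3 => v p.1 p.2) (genericMatrix mult F).det ≠ 0)
    (c : Conds mult → K) :
    ∃ G : CoordRing K, G.IsHomogeneous t ∧ evalMap mult v G = c := by
  rw [eval_det_genericMatrix] at h
  set M : Matrix (Conds mult) (Conds mult) K := Matrix.of fun x y => evalMap mult v (F y) x
  refine ⟨∑ y, (M⁻¹.mulVec c y) • F y, ?_, ?_⟩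
  · exact Submodule.sum_mem (homogeneousSubmodule (Fin 3) K t)
      fun y _ => Submodule.smul_mem _ _ (hF y)
  · have h3 : M.mulVec (M⁻¹.mulVec c) = c := by
      rw [Matrix.mulVec_mulVec, Matrix.mul_nonsing_inv _ h.isUnit, Matrix.one_mulVec]
    refine Eq.trans ?_ h3
    rw [map_sum]
    ext x
    rw [Finset.sum_apply, Matrix.mulVec, dotProduct]
    refine Finset.sum_congr rfl fun y _ => ?_
    rw [map_smul, Pi.smul_apply, smul_eq_mul, mul_comm]
    rfl

theorem isWeightedHomogeneous_det_genericMatrix {mult : ι → ℕ} {F : Conds mult → CoordRing K}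
    {t : ℕ} (hF : ∀ y, (F y).IsHomogeneous t) :
    IsWeightedHomogeneous (multiWeight ι) (genericMatrix mult F).det
      (∑ x : Conds mult, Pi.single x.1 (t - x.2.exponent.degree)) :=
  isWeightedHomogeneous_det fun _ y => isWeightedHomogeneous_rename
    ((isBihomogeneous_genericExpand (hF y)).isHomogeneous_coeff _) _

/-- The product of the polynomials that express that the points lie in the affine chart and are
pairwise distinct. -/
def chartPoly (K : Type*) [Field K] (ι : Type*) [Fintype ι] [DecidableEq ι] :
    MvPolynomial (ι × Fin 3) K :=
  (∏ j : ι, X (j, 0)) *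
    ∏ x ∈ (Finset.univ : Finset (ι × ι)).filter (fun x => x.1 ≠ x.2),
      (X (x.1, 0) * X (x.2, 1) - X (x.2, 0) * X (x.1, 1))

theorem isWeightedHomogeneous_chartPoly : ∃ D, IsWeightedHomogeneous (multiWeight ι)
    (chartPoly K ι) D := by
  have hX : ∀ p : ι × Fin 3, IsWeightedHomogeneous (multiWeight ι) (X p : MvPolynomial _ K)
    (Pi.single p.1 1) := fun p => isWeightedHomogeneous_X _ _ p
  refine ⟨_, (IsWeightedHomogeneous.prod _ _ _ fun j _ => hX (j, 0)).mul
    (IsWeightedHomogeneous.prod _ _ (fun x : ι × ι => Pi.single x.1 1 + Pi.single x.2 1)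
      fun _ _ => ((hX _).mul (hX _)).sub ?_)⟩
  rw [add_comm]
  exact (hX _).mul (hX _)

theorem chartPoly_ne_zero : chartPoly K ι ≠ 0 := by
  refine mul_ne_zero (Finset.prod_ne_zero_iff.2 fun j _ => X_ne_zero _)
    (Finset.prod_ne_zero_iff.2 fun x hx h => ?_)
  have hne := (Finset.mem_filter.1 hx).2
  have h1 := congrArg (eval fun p : ι × Fin 3 =>
    if p = (x.1, 0) ∨ p = (x.2, 1) then (1 : K) else 0) h
  simp [hne, Ne.symm hne] at h1

theorem eval_chartPoly_ne_zero {v : ι → Fin 3 → K}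
    (h : eval (fun p : ι × Fin 3 => v p.1 p.2) (chartPoly K ι) ≠ 0) :
    (∀ j, v j 0 ≠ 0) ∧ Function.Injective v := by
  rw [chartPoly, map_mul, map_prod, map_prod] at h
  have h1 := Finset.prod_ne_zero_iff.1 (left_ne_zero_of_mul h)
  have h2 := Finset.prod_ne_zero_iff.1 (right_ne_zero_of_mul h)
  refine ⟨fun j => by simpa using h1 j (Finset.mem_univ j), fun j k hjk => ?_⟩
  by_contra hne
  refine h2 (j, k) (Finset.mem_filter.2 ⟨Finset.mem_univ _, hne⟩) ?_
  simp [hjk]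

/-- If the conditions imposed by some points with multiplicities `mult` can be met with arbitrary
values by forms of degree `t`, then the same holds for general points. -/
theorem forGeneralPoints_of_exists [Infinite K] {mult : ι → ℕ} {t : ℕ}
    (h : ∃ v : ι → Fin 3 → K, ∀ c, ∃ F : CoordRing K, F.IsHomogeneous t ∧ evalMap mult v F = c)
    {p : (ι → P2 K) → Prop}
    (hp : ∀ P : ι → P2 K, Function.Injective P → (∀ j, (P j).rep 0 ≠ 0) →
      (∀ c, ∃ F : CoordRing K, F.IsHomogeneous t ∧ evalMap mult (fun j => (P j).rep) F = c) →
      p P) :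
    ForGeneralPoints p := by
  obtain ⟨v, hv⟩ := h
  choose F hF hFv using fun y : Conds mult => hv (Pi.single y 1)
  set g := (genericMatrix mult F).det * chartPoly K ι with hg
  have hdet : (genericMatrix mult F).det ≠ 0 := by
    intro h0
    have h1 := congrArg (eval fun p : ι × Fin 3 => v p.1 p.2) h0
    rw [map_zero, eval_det_genericMatrix] at h1
    have h2 : (Matrix.of fun x y => evalMap mult v (F y) x) =
        (1 : Matrix (Conds mult) (Conds mult) K) := by
      ext x y
      rw [Matrix.of_apply, hFv, Matrix.one_apply, Pi.single_apply]
    rw [h2, Matrix.det_one] at h1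
    exact one_ne_zero h1
  have hg0 : g ≠ 0 := mul_ne_zero hdet chartPoly_ne_zero
  obtain ⟨D, hD⟩ : ∃ D, IsWeightedHomogeneous (multiWeight ι) g D := by
    obtain ⟨D, hD⟩ := isWeightedHomogeneous_chartPoly (K := K) (ι := ι)
    exact ⟨_, (isWeightedHomogeneous_det_genericMatrix hF).mul hD⟩
  refine ⟨{P | eval (fun p : ι × Fin 3 => (P p.1).rep p.2) g ≠ 0}, ⟨{g}, ?_, ?_⟩, ?_, ?_⟩
  · rintro _ rfl
    exact ⟨D, hD⟩
  · intro P
    simp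
  · obtain ⟨w, hw⟩ : ∃ w : ι × Fin 3 → K, eval w g ≠ 0 := by
      by_contra hall
      push Not at hall
      exact hg0 (MvPolynomial.funext fun w => by rw [hall w, map_zero])
    let w' : ι → Fin 3 → K := fun j i => w (j, i)
    have hw' : eval (fun p : ι × Fin 3 => w' p.1 p.2) g ≠ 0 := hw
    have h0 : ∀ j, w' j ≠ 0 := by
      intro j hj
      rw [hg, map_mul] at hw'
      exact (eval_chartPoly_ne_zero (right_ne_zero_of_mul hw')).1 j (by rw [hj]; rfl)
    choose a ha using fun j => Projectivization.exists_smul_eq_mk_rep K (w' j) (h0 j)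
    let u : ι → Fin 3 → K := fun j => (Projectivization.mk K (w' j) (h0 j)).rep
    have hu : eval (fun p : ι × Fin 3 => u p.1 p.2) g ≠ 0 := by
      refine eval_smul_ne_zero hD (v := w') (w := u) (fun j => (((a j)⁻¹ : Kˣ) : K))
        (fun j => ?_) hw'
      change w' j = _ • (Projectivization.mk K (w' j) (h0 j)).rep
      rw [← ha j, Units.smul_def, smul_smul, Units.inv_mul, one_smul]
    exact ⟨fun j => Projectivization.mk K (w' j) (h0 j), hu⟩
  · intro P hP
    rw [Set.mem_ofPred_eq, hg, map_mul] at hP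
    let w : ι → Fin 3 → K := fun j => (P j).rep
    have hP₁ : eval (fun p : ι × Fin 3 => w p.1 p.2) (genericMatrix mult F).det ≠ 0 :=
      left_ne_zero_of_mul hP
    have hP₂ : eval (fun p : ι × Fin 3 => w p.1 p.2) (chartPoly K ι) ≠ 0 :=
      right_ne_zero_of_mul hP
    obtain ⟨h1, h2⟩ := eval_chartPoly_ne_zero hP₂
    have hinj : Function.Injective P := fun j k hjk => h2 (by simp only [w, hjk])
    exact ⟨hinj, hp P hinj h1 fun c => exists_evalMap_eq_of_eval_det_ne_zero hF hP₁ c⟩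

end GenericPoints

/-! ### Vanishing of the first cohomology -/

/-- A power of the ideal of the origin is primary: a factor that does not vanish at the origin can
be cancelled. -/
theorem mem_idealOfVars_pow_of_mul_mem {p q : MvPolynomial (Fin 2) K} {d : ℕ}
    (h : p * q ∈ idealOfVars (Fin 2) K ^ d) (hq : constantCoeff q ≠ 0) :
    p ∈ idealOfVars (Fin 2) K ^ d := by
  have key : ∀ f : MvPolynomial (Fin 2) K, f ∈ idealOfVars (Fin 2) K ^ d ↔
      Polynomial.X ^ d ∣ taylorAt (0 : K × K) f := by
    intro f
    rw [pow_dvd_taylorAt_iff, forall_cond_iff, translate_zero, AlgHom.id_apply]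
  rw [key, map_mul] at h
  rw [key]
  refine Polynomial.prime_X.pow_dvd_of_dvd_mul_right _ ?_ h
  rw [Polynomial.X_dvd_iff, coeff_taylorAt, homogeneousComponent_zero]
  intro h0
  have h1 := C_injective (Fin 2) K (h0.trans C_0.symm)
  refine hq ?_
  rw [← h1, translate_zero]
  rfl

section Homogeneous

variable {σ : Type*}

theorem homogeneousComponent_mul_of_isHomogeneous {b : MvPolynomial σ K} {s : ℕ}
    (hb : b.IsHomogeneous s) (A : MvPolynomial σ K) (n : ℕ) :
    homogeneousComponent (n + s) (A * b) = homogeneousComponent n A * b := by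
  induction A using MvPolynomial.induction_on' with
  | monomial m a =>
    have h1 := isHomogeneous_monomial (R := K) a (rfl : m.degree = m.degree)
    rw [homogeneousComponent_of_mem (h1.mul hb), homogeneousComponent_of_mem h1]
    by_cases h : n = m.degree
    · rw [if_pos (by omega), if_pos h]
    · rw [if_neg (by omega), if_neg h, zero_mul]
  | add p q hp hq => rw [add_mul, map_add, map_add, hp, hq, add_mul]

theorem isHomogeneous_of_mul {A b : MvPolynomial σ K} {n s : ℕ} (hb : b.IsHomogeneous s)
    (hb0 : b ≠ 0) (h : (A * b).IsHomogeneous (n + s)) : A.IsHomogeneous n := by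
  have h1 := homogeneousComponent_mul_of_isHomogeneous hb A n
  rw [homogeneousComponent_eq_self h] at h1
  rw [mul_right_cancel₀ hb0 h1]
  exact homogeneousComponent_isHomogeneous _ _

theorem eval_smul_of_isHomogeneous [Fintype σ] {F : MvPolynomial σ K} {n : ℕ}
    (hF : F.IsHomogeneous n) (a : K) (v : σ → K) : eval (a • v) F = a ^ n * eval v F := by
  rw [eval_eq', eval_eq', Finset.mul_sum]
  refine Finset.sum_congr rfl fun m hm => ?_
  have h1 := hF (mem_support_iff.1 hm)
  rw [weight_one_apply, Finsupp.degree_eq_sum] at h1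
  rw [← h1, ← Finset.prod_pow_eq_pow_sum, mul_left_comm, ← Finset.prod_mul_distrib]
  simp only [Pi.smul_apply, smul_eq_mul, mul_pow]

theorem not_X_dvd_X_pow {i j : σ} (h : i ≠ j) (N : ℕ) :
    ¬ (X i : MvPolynomial σ K) ∣ X j ^ N := fun hd =>
  h (X_dvd_X.1 ((X_prime (i := i)).dvd_of_dvd_pow hd))

/-- The powers of three variables form a regular sequence: a relation that involves the power of
the second one lies in the ideal of the other two. -/
theorem exists_eq_add_of_mul_pow {i j k : σ} (hij : i ≠ j) (hjk : j ≠ k) {N : ℕ}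
    {A B D : MvPolynomial σ K} (h : D * X j ^ N = A * X k ^ N + B * X i ^ N) :
    ∃ U W : MvPolynomial σ K, D = U * X i ^ N + W * X k ^ N := by
  classical
  have key : ∀ x : MvPolynomial σ K, (∃ U W, x = U * X i ^ N + W * X k ^ N) ↔
      ∀ m ∈ x.support, N ≤ m i ∨ N ≤ m k := by
    intro x
    have h1 : (∃ U W, x = U * X i ^ N + W * X k ^ N) ↔
        x ∈ Ideal.span ((fun s => monomial s (1 : K)) ''
          {Finsupp.single i N, Finsupp.single k N}) := by
      rw [Set.image_pair, Ideal.mem_span_pair]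
      simp only [X_pow_eq_monomial, eq_comm]
    rw [h1, mem_ideal_span_monomial_image]
    simp [Finsupp.single_le_iff]
  rw [key]
  intro m hm
  have h2 := (key (D * X j ^ N)).1 ⟨B, A, by rw [h, add_comm]⟩ (m + Finsupp.single j N) (by
    rw [mem_support_iff, X_pow_eq_monomial, coeff_mul_monomial, mul_one]
    exact mem_support_iff.1 hm)
  simpa [Finsupp.single_eq_of_ne hij, Finsupp.single_eq_of_ne hjk.symm] using h2

end Homogeneous

/-- A section of `I_Z(t)` over the intersection of two members of the standard cover is a fraction
whose denominator is a power of the product of the two coordinates. -/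
theorem exists_numerator [IsAlgClosed K] {ι : Type*} {P : ι → P2 K} {mult : ι → ℕ} {t : ℕ}
    {i j : Fin 3} {F : RatField K}
    (hF : F ∈ idealSheafSections P mult t (stdAffine i ∩ stdAffine j)) :
    ∃ N₀, ∀ N ≥ N₀, ∃ A : CoordRing K, A.IsHomogeneous (N + t + N) ∧
      F * algebraMap (CoordRing K) (RatField K) (X i * X j) ^ N = algebraMap _ _ A ∧
      ∀ l, (P l).rep i ≠ 0 → (P l).rep j ≠ 0 →
        expand (P l).rep A ∈ idealOfVars (Fin 2) K ^ mult l := by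
  have hinj := IsFractionRing.injective (CoordRing K) (RatField K)
  let J : Ideal (CoordRing K) :=
    { carrier := {b | ∃ a : CoordRing K,
        F * algebraMap (CoordRing K) (RatField K) b = algebraMap _ _ a}
      zero_mem' := ⟨0, by simp⟩
      add_mem' := by
        rintro b b' ⟨a, ha⟩ ⟨a', ha'⟩
        exact ⟨a + a', by rw [map_add, map_add, mul_add, ha, ha']⟩
      smul_mem' := by
        rintro c b ⟨a, ha⟩
        exact ⟨c * a, by rw [smul_eq_mul, map_mul, map_mul, mul_left_comm, ha]⟩ }
  have hsec : ∀ Q : P2 K, Q.rep i ≠ 0 → Q.rep j ≠ 0 → ∃ (s : ℕ) (a b : CoordRing K),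
      a.IsHomogeneous (s + t) ∧ b.IsHomogeneous s ∧ eval Q.rep b ≠ 0 ∧
      (∀ l, P l = Q → a ∈ pointIdeal Q ^ mult l) ∧
      F * algebraMap (CoordRing K) (RatField K) b = algebraMap _ _ a := by
    intro Q hQi hQj
    obtain ⟨s, a, b, ha, hb, hbQ, haP, h⟩ := hF Q ⟨hQi, hQj⟩
    refine ⟨s, a, b, ha, hb, hbQ, haP, ?_⟩
    rw [h, div_mul_cancel₀]
    intro h0
    rw [map_eq_zero_iff _ hinj] at h0
    exact hbQ (by rw [h0, map_zero])
  have hrad : (X i * X j : CoordRing K) ∈ J.radical := by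
    rw [← vanishingIdeal_zeroLocus_eq_radical (K := K), mem_vanishingIdeal_iff]
    intro v hv
    by_contra hne
    rw [map_mul, aeval_X, aeval_X] at hne
    have hvi := left_ne_zero_of_mul hne
    have hvj := right_ne_zero_of_mul hne
    have hv0 : v ≠ 0 := fun h => hvi (by rw [h]; rfl)
    obtain ⟨a, ha⟩ := Projectivization.exists_smul_eq_mk_rep K v hv0
    rw [Units.smul_def] at ha
    obtain ⟨s, c, b, -, hb, hbQ, -, h⟩ := hsec (Projectivization.mk K v hv0)
      (by rw [← ha]; exact mul_ne_zero a.ne_zero hvi)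
      (by rw [← ha]; exact mul_ne_zero a.ne_zero hvj)
    rw [← ha, eval_smul_of_isHomogeneous hb] at hbQ
    exact right_ne_zero_of_mul hbQ (hv b ⟨c, h⟩)
  obtain ⟨N₀, hN₀⟩ := hrad
  refine ⟨N₀, fun N hN => ?_⟩
  obtain ⟨A, hA⟩ : (X i * X j : CoordRing K) ^ N ∈ J := J.pow_mem_of_pow_mem hN₀ hN
  rw [map_pow] at hA
  have hcross : ∀ {a b : CoordRing K},
      F * algebraMap (CoordRing K) (RatField K) b = algebraMap _ _ a →
      A * b = a * (X i * X j) ^ N := by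
    intro a b h
    apply hinj
    rw [map_mul, map_mul, ← hA, ← h, map_pow]
    ring
  have hXX : ((X i * X j : CoordRing K) ^ N).IsHomogeneous (N + N) := by
    rw [mul_pow]
    exact (isHomogeneous_X_pow i N).mul (isHomogeneous_X_pow j N)
  refine ⟨A, ?_, hA, fun l hi hj => ?_⟩
  · have hone : (fun _ => 1 : Fin 3 → K) ≠ 0 := fun h => one_ne_zero (congrFun h 0)
    obtain ⟨c, hc⟩ := Projectivization.exists_smul_eq_mk_rep K (fun _ => 1 : Fin 3 → K) hone
    rw [Units.smul_def] at hc
    obtain ⟨s, a, b, ha, hb, hbQ, -, h⟩ := hsec (Projectivization.mk K _ hone)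
      (by rw [← hc]; exact mul_ne_zero c.ne_zero one_ne_zero)
      (by rw [← hc]; exact mul_ne_zero c.ne_zero one_ne_zero)
    refine isHomogeneous_of_mul hb (fun h0 => hbQ (by rw [h0, map_zero])) ?_
    rw [hcross h, show N + t + N + s = s + t + (N + N) by ring]
    exact ha.mul hXX
  · obtain ⟨s, a, b, ha, hb, hbQ, haP, h⟩ := hsec (P l) hi hj
    have h1 := expand_mem_of_mem_pointIdeal_pow (haP l rfl)
    refine mem_idealOfVars_pow_of_mul_mem (q := expand (P l).rep b) ?_
      (by rwa [constantCoeff_expand])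
    rw [← map_mul, hcross h, map_mul]
    exact Ideal.mul_mem_right _ _ h1

/-- Fractions with a power of a coordinate as denominator are sections of `I_Z(t)` where this
coordinate does not vanish, provided that their numerators vanish suitably. -/
theorem div_pow_mem_idealSheafSections {ι : Type*} {P : ι → P2 K} {mult : ι → ℕ} {t N : ℕ}
    (hP : ∀ l, (P l).rep 0 ≠ 0) {i : Fin 3} {A : CoordRing K} (hA : A.IsHomogeneous (N + t))
    (h : ∀ l, (P l).rep i ≠ 0 → expand (P l).rep A ∈ idealOfVars (Fin 2) K ^ mult l) :
    algebraMap (CoordRing K) (RatField K) A / algebraMap (CoordRing K) (RatField K) (X i ^ N) ∈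
      idealSheafSections P mult t (stdAffine i) := by
  intro Q hQ
  refine ⟨N, A, X i ^ N, hA, isHomogeneous_X_pow i N, ?_, ?_, rfl⟩
  · rw [map_pow, eval_X]
    exact pow_ne_zero _ hQ
  · rintro l rfl
    exact (mem_pointIdeal_pow_iff (hP l) hA).2 (h l hQ)

/-- If the conditions at the points can be met with arbitrary values by forms of degree `t`, then
all Čech cocycles of `I_Z(t)` are coboundaries. -/
theorem cechZ1_le_cechB1 [IsAlgClosed K] {ι : Type*} {P : ι → P2 K} {mult : ι → ℕ} {t : ℕ}
    (hP : ∀ l, (P l).rep 0 ≠ 0)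
    (hsurj : ∀ c, ∃ F : CoordRing K,
      F.IsHomogeneous t ∧ evalMap mult (fun j => (P j).rep) F = c) :
    cechZ1 P mult t ≤ cechB1 P mult t := by
  rintro g ⟨hg, hcoc⟩
  have hinj := IsFractionRing.injective (CoordRing K) (RatField K)
  obtain ⟨N₁, h₁⟩ := exists_numerator (hg 0 1)
  obtain ⟨N₂, h₂⟩ := exists_numerator (hg 1 2)
  obtain ⟨N₃, h₃⟩ := exists_numerator (hg 0 2)
  set N := max N₁ (max N₂ N₃)
  obtain ⟨A, hA, hgA, hAP⟩ := h₁ N (le_max_left _ _)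
  obtain ⟨B, hB, hgB, hBP⟩ := h₂ N ((le_max_left _ _).trans (le_max_right _ _))
  obtain ⟨D, hD, hgD, hDP⟩ := h₃ N ((le_max_right _ _).trans (le_max_right _ _))
  set φ := algebraMap (CoordRing K) (RatField K) with hφ
  have hX : ∀ i : Fin 3, φ (X i) ≠ 0 := fun i h =>
    X_ne_zero i ((map_eq_zero_iff _ hinj).1 h)
  have hXh : ∀ i : Fin 3, (X i ^ N : CoordRing K).IsHomogeneous N :=
    fun i => isHomogeneous_X_pow i N
  have hX0 : ∀ i : Fin 3, (X i ^ N : CoordRing K) ≠ 0 := fun i => pow_ne_zero _ (X_ne_zero i)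
  have hrel : D * X 1 ^ N = A * X 2 ^ N + B * X 0 ^ N := by
    apply hinj
    have h012 := hcoc 0 1 2
    simp only [map_mul, map_add, map_pow, ← hφ] at *
    rw [← hgA, ← hgB, ← hgD]
    linear_combination (-(φ (X 0) ^ N * φ (X 1) ^ N * φ (X 2) ^ N)) * h012
  obtain ⟨U', W', hUW'⟩ := exists_eq_add_of_mul_pow (by decide) (by decide) hrel
  -- the coefficients of the relation can be taken homogeneous
  obtain ⟨U, W, hU, hW, hUW⟩ : ∃ U W : CoordRing K, U.IsHomogeneous (N + t) ∧
      W.IsHomogeneous (N + t) ∧ D = U * X 0 ^ N + W * X 2 ^ N := by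
    refine ⟨homogeneousComponent (N + t) U', homogeneousComponent (N + t) W',
      homogeneousComponent_isHomogeneous _ _, homogeneousComponent_isHomogeneous _ _, ?_⟩
    have h := congrArg (homogeneousComponent (N + t + N)) hUW'
    rwa [map_add, homogeneousComponent_mul_of_isHomogeneous (hXh 0),
      homogeneousComponent_mul_of_isHomogeneous (hXh 2), homogeneousComponent_eq_self hD] at h
  have hrel' : X 2 ^ N * (A - W * X 1 ^ N) = X 0 ^ N * (U * X 1 ^ N - B) := by
    rw [hUW] at hrel
    linear_combination -hrel
  obtain ⟨V, hV⟩ : X 0 ^ N ∣ A - W * X 1 ^ N :=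
    (X_prime (i := (0 : Fin 3))).pow_dvd_of_dvd_mul_left N (not_X_dvd_X_pow (by decide) N)
      ⟨_, hrel'⟩
  have hV' : U * X 1 ^ N - B = X 2 ^ N * V := by
    refine mul_left_cancel₀ (hX0 0) ?_
    rw [← hrel', hV]
    ring
  have hVh : V.IsHomogeneous (N + t) := by
    refine isHomogeneous_of_mul (hXh 0) (hX0 0) ?_
    rw [mul_comm, ← hV]
    exact hA.sub (hW.mul (hXh 1))
  -- a form of degree `t` corrects the local primitives at the points
  obtain ⟨F, hF, hFc⟩ := hsurj fun x =>
    -((P x.1).rep 0 ^ N)⁻¹ * coeff x.2.exponent (expand (P x.1).rep W)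
  have hexp : ∀ (l : ι), expand (P l).rep (X 0 ^ N) = C ((P l).rep 0 ^ N) := by
    intro l
    simp [expand]
  have key0 : ∀ l, expand (P l).rep (-W - F * X 0 ^ N) ∈ idealOfVars (Fin 2) K ^ mult l := by
    intro l
    rw [← forall_cond_iff]
    intro x
    have h := congrFun hFc ⟨l, x⟩
    rw [evalMap_apply] at h
    simp only at h
    rw [map_sub, map_mul, hexp, map_neg, coeff_sub, coeff_neg, mul_comm (expand _ F),
      coeff_C_mul, h]
    have := pow_ne_zero N (hP l)
    field_simp
    ring
  have hcancel : ∀ (l : ι) (G : CoordRing K),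
      expand (P l).rep (G * X 0 ^ N) ∈ idealOfVars (Fin 2) K ^ mult l →
      expand (P l).rep G ∈ idealOfVars (Fin 2) K ^ mult l := by
    intro l G h
    rw [map_mul, hexp] at h
    refine mem_idealOfVars_pow_of_mul_mem h ?_
    rw [constantCoeff_C]
    exact pow_ne_zero N (hP l)
  have key1 : ∀ l, (P l).rep 1 ≠ 0 →
      expand (P l).rep (V - F * X 1 ^ N) ∈ idealOfVars (Fin 2) K ^ mult l := by
    intro l hl
    refine hcancel l _ ?_
    rw [show (V - F * X 1 ^ N) * X 0 ^ N = A + X 1 ^ N * (-W - F * X 0 ^ N) by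
      linear_combination -hV, map_add, map_mul]
    exact Ideal.add_mem _ (hAP l (hP l) hl) (Ideal.mul_mem_left _ _ (key0 l))
  have key2 : ∀ l, (P l).rep 2 ≠ 0 →
      expand (P l).rep (U - F * X 2 ^ N) ∈ idealOfVars (Fin 2) K ^ mult l := by
    intro l hl
    refine hcancel l _ ?_
    rw [show (U - F * X 2 ^ N) * X 0 ^ N = D + X 2 ^ N * (-W - F * X 0 ^ N) by
      linear_combination -hUW, map_add, map_mul]
    exact Ideal.add_mem _ (hDP l (hP l) hl) (Ideal.mul_mem_left _ _ (key0 l))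
  have hFX : ∀ i : Fin 3, (F * X i ^ N).IsHomogeneous (N + t) := fun i => by
    rw [add_comm]
    exact hF.mul (hXh i)
  let f : Fin 3 → RatField K := ![φ (-W - F * X 0 ^ N) / φ (X 0 ^ N),
    φ (V - F * X 1 ^ N) / φ (X 1 ^ N), φ (U - F * X 2 ^ N) / φ (X 2 ^ N)]
  have h01 : g 0 1 = f 1 - f 0 := by
    have e : g 0 1 = φ A / (φ (X 0) ^ N * φ (X 1) ^ N) := by
      rw [eq_div_iff (mul_ne_zero (pow_ne_zero _ (hX 0)) (pow_ne_zero _ (hX 1))), ← hgA, map_mul,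
        mul_pow]
    have e' : A = W * X 1 ^ N + X 0 ^ N * V := by linear_combination hV
    rw [e, e']
    simp only [f, Matrix.cons_val_zero, Matrix.cons_val_one, map_sub, map_add, map_mul, map_neg,
      map_pow]
    have := hX 0
    have := hX 1
    field_simp
    ring
  have h02 : g 0 2 = f 2 - f 0 := by
    have e : g 0 2 = φ D / (φ (X 0) ^ N * φ (X 2) ^ N) := by
      rw [eq_div_iff (mul_ne_zero (pow_ne_zero _ (hX 0)) (pow_ne_zero _ (hX 2))), ← hgD, map_mul,
        mul_pow]
    rw [e, hUW]
    simp only [f, Matrix.cons_val_zero, Matrix.cons_val, map_sub, map_add, map_mul, map_neg,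
      map_pow]
    have := hX 0
    have := hX 2
    field_simp
    ring
  refine ⟨f, fun i => ?_, fun i j => ?_⟩
  · fin_cases i
    · exact div_pow_mem_idealSheafSections hP (hW.neg.sub (hFX 0)) fun l _ => key0 l
    · exact div_pow_mem_idealSheafSections hP (hVh.sub (hFX 1)) key1
    · exact div_pow_mem_idealSheafSections hP (hU.sub (hFX 2)) key2
  · have h00 : g 0 0 = 0 := by
      have := hcoc 0 0 0
      rwa [sub_self, zero_add] at this
    have h0 : ∀ k, g 0 k = f k - f 0 := by
      intro k
      fin_cases k
      · exact h00.trans (sub_self _).symm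
      · exact h01
      · exact h02
    have := hcoc 0 i j
    rw [h0 i, h0 j] at this
    linear_combination this

theorem h1_eq_zero [IsAlgClosed K] {ι : Type*} {P : ι → P2 K} {mult : ι → ℕ} {t : ℕ}
    (hP : ∀ l, (P l).rep 0 ≠ 0)
    (hsurj : ∀ c, ∃ F : CoordRing K,
      F.IsHomogeneous t ∧ evalMap mult (fun j => (P j).rep) F = c) :
    h1 P mult t = 0 := by
  have h : (cechB1 P mult t).submoduleOf (cechZ1 P mult t) = ⊤ :=
    Submodule.submoduleOf_eq_top.2 (cechZ1_le_cechB1 hP hsurj)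
  have : Subsingleton (H1 P mult t) := Submodule.Quotient.subsingleton_iff.2 h
  exact rank_subsingleton' K _

end FatPoints

end

theorem theorem0p1 {K : Type*} [Field K] [IsAlgClosed K] [CharZero K]
    (t r e : ℕ) (ht : 0 < t) (hr : 0 < r) (he : 0 < e)
    (d : Fin r → ℕ) (hd : ∀ j, 0 < d j)
    (mult : Fin (r + e) → ℕ) (hmult : mult = Fin.append d (fun _ : Fin e => 2))
    (m : ℕ) (hm : m = Finset.univ.sup mult)
    (hlen : ((t : ℚ) + 2) * ((t : ℚ) + 1) / 2 ≥
      1 + ∑ j, (mult j : ℚ) * ((mult j : ℚ) + 1) / 2)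
    (hnodes : (e : ℚ) ≥ ((m : ℚ) - 1) * ((t : ℚ) - 1) / 2) :
    FatPoints.ForGeneralPoints (fun P : Fin (r + e) → FatPoints.P2 K =>
      FatPoints.h1 P mult t = 0 ∧ FatPoints.ImposesIndependentConditions P mult t) := by
  have hpos : ∀ j, 1 ≤ mult j := by
    intro j
    rw [hmult]
    refine Fin.addCases (fun i => ?_) (fun i => ?_) j
    · rw [Fin.append_left]
      exact hd i
    · rw [Fin.append_right]
      norm_num
  have hS : ∀ a ∈ Finset.univ.val.map mult, 1 ≤ a ∧ a ≤ m := by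
    intro a ha
    obtain ⟨j, -, rfl⟩ := Multiset.mem_map.1 ha
    exact ⟨hpos j, hm ▸ Finset.le_sup (Finset.mem_univ j)⟩
  have htwo : e ≤ (Finset.univ.val.map mult).count 2 := by
    rw [Multiset.le_count_iff_replicate_le]
    have h1 : (Finset.univ.map (Fin.natAddEmb r : Fin e ↪ Fin (r + e))).val ≤
        (Finset.univ : Finset (Fin (r + e))).val := Finset.val_le_iff.2 (Finset.subset_univ _)
    refine le_trans (le_of_eq ?_) (Multiset.map_le_map h1)
    rw [Finset.map_val, Multiset.map_map, hmult, eq_comm, Multiset.eq_replicate]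
    refine ⟨by simp, fun b hb => ?_⟩
    obtain ⟨i, -, rfl⟩ := Multiset.mem_map.1 hb
    exact Fin.append_right d _ i
  have hsize : (FatPoints.size (Finset.univ.val.map mult) : ℚ) =
      ∑ j, (mult j : ℚ) * ((mult j : ℚ) + 1) / 2 := by
    rw [FatPoints.size, Multiset.map_map]
    change ((∑ j, ((mult j * (mult j + 1) / 2 : ℕ) : ℤ) : ℤ) : ℚ) = _
    rw [Int.cast_sum]
    refine Finset.sum_congr rfl fun j _ => ?_
    have h1 := FatPoints.two_mul_triangle (mult j)
    have h2 : (2 : ℚ) * (((mult j * (mult j + 1) / 2 : ℕ) : ℤ) : ℚ) = mult j * (mult j + 1) := by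
      exact_mod_cast h1
    linarith
  have hlen' : 2 * FatPoints.size (Finset.univ.val.map mult) + 2 ≤ ((t : ℤ) + 1) * (t + 2) := by
    rw [← hsize] at hlen
    have h1 : (2 * FatPoints.size (Finset.univ.val.map mult) + 2 : ℚ) ≤ (t + 1) * (t + 2) := by
      linarith
    exact_mod_cast h1
  have hnodes' : ((m : ℤ) - 1) * (t - 1) ≤ 2 * e := by
    have h1 : ((m : ℚ) - 1) * (t - 1) ≤ 2 * e := by linarith
    exact_mod_cast h1
  obtain ⟨Z, hZ, hdim⟩ := FatPoints.exists_dim_add_size_eq (K := K) hS he htwo hlen' hnodes'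
  exact FatPoints.forGeneralPoints_of_exists
    (FatPoints.exists_forall_exists_evalMap_eq mult hZ hdim)
    fun P _ h0 hsurj => ⟨FatPoints.h1_eq_zero h0 hsurj,
      FatPoints.imposesIndependentConditions h0 hsurj⟩
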